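/- **Setting.** Let $R$ be a commutative $\mathbb{Q}$-algebra ("functions of the times $t_1=x,t_2,\ldots$ and $\bar t_1,\bar t_2,\ldots$") with pairwise commuting derivations $\partial/\partial t_l$ and $\partial/\partial\bar t_s$ ($l,s\ge 1$). Write $\partial=\partial/\partial t_1$, $\bar\partial=\partial/\partial\bar t_1$, and let $D$, $\bar D$ be the corresponding symbols in the rings of formal pseudo-differential operators $\sum_{n\le N}a_nD^n$ and $\sum_{n\le N}a_n\bar D^n$ over $R$. For such an operator $A$, $A_+$ and $A_-$ are the parts with $n\ge 0$ and $n<0$, $A^*$ is the formal adjoint, and a differential operator $A$ acts on functions by $A(f)$. Write $\partial\ln f=\partial f/f$, and similarly for the other derivations. Let $\mathcal L=D+\sum_{i\ge1}u_iD^{-i}$ satisfy the KP hierarchy $\partial\mathcal L/\partial t_l=[(\mathcal L^l)_+,\mathcal L]$ for all $l\ge1$, and let $\Phi_k,\Psi_k$ ($k\ge1$) be eigenfunctions and adjoint eigenfunctions, $\partial\Phi_k/\partial t_l=(\mathcal L^l)_+(\Phi_k)$, $\partial\Psi_k/\partial t_l=-((\mathcal L^*)^l)_+(\Psi_k)$.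 Suppose that functions $\partial^{-1}(\Phi_k\Psi_j)$ with $\partial\,\partial^{-1}(\Phi_k\Psi_j)=\Phi_k\Psi_j$ are given such that the ghost flows hold for all $s,k\ge1$: $$\frac{\partial\mathcal L}{\partial\bar t_s}=[\mathcal M_s,\mathcal L],\quad \mathcal M_s=\sum_{j=1}^s\Phi_{s-j+1}D^{-1}\Psi_j,$$ $$\frac{\partial\Phi_k}{\partial\bar t_s}=\sum_{j=1}^s\Phi_{s-j+1}\partial^{-1}(\Psi_j\Phi_k)-\Phi_{k+s},\qquad \frac{\partial\Psi_k}{\partial\bar t_s}=\sum_{j=1}^s\Psi_j\,\partial^{-1}(\Phi_{s-j+1}\Psi_k)+\Psi_{k+s}.$$ Let $W_k[f_1,\ldots,f_k]=\det\|\partial^{\alpha-1}f_\beta\|_{\alpha,\beta=1}^k$ denote the Wronskian, $W_k=W_k[\Phi_1,\ldots,\Phi_k]$, $\mathcal W_k=W_k[\Psi_1,\ldots,\Psi_k]$, $\mathcal W_0=1$, $\mathcal W_k(F)=W_{k+1}[\Psi_1,\ldots,\Psi_k,F]$, and suppose that all $W_k$ and $\mathcal W_k$, $k\ge1$, are invertible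 in $R$. Define the $\bar\partial$-differential operators $$\bar M_s=\sum_{j=1}^s\Big(\sum_{k=j}^s\frac{\Phi_{s-k+1}}{\Phi_1}\frac{\mathcal W_{j-1}(\Psi_k)}{\mathcal W_j}\Big)\Big(\bar D-\bar\partial\ln\frac{\mathcal W_{j-1}}{\mathcal W_{j-2}}\Big)\cdots\big(\bar D-\bar\partial\ln\Psi_1\big)\Big(\bar D-\bar\partial\ln\frac1{\Phi_1}\Big)-\frac{\partial}{\partial\bar t_s}\ln\Phi_1$$ (the product has $j$ factors). **Statement.** There is exactly one operator $\bar{\mathcal L}=\bar D+\sum_{i\ge1}\bar u_i\bar D^{-i}$ with $\bar M_s=(\bar{\mathcal L}^s)_+$ for all $s\ge1$. It has the form $$\bar{\mathcal L}=\bar D+\sum_{k\ge1}b_k\Big(\bar D+\bar\partial\ln\frac{W_{k+1}}{W_k}\Big)^{-1}\cdots\Big(\bar D+\bar\partial\ln\frac{W_2}{\Phi_1}\Big)^{-1}$$ with $b_k\in R$ and $b_1=-\bar\partial(\Phi_2/\Phi_1)$, and its dressing operator is given explicitly by $$\bar{\mathcal L}=\bar W\bar D\bar W^{-1},\qquad \bar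 W=1+\sum_{s=1}^\infty\frac{\Phi_{s+1}}{\Phi_1}\bar D^{-s};$$ that is, $\bar W$ is invertible, this identity holds, and $\partial\bar W/\partial\bar t_s=-(\bar{\mathcal L}^s)_-\bar W$ for all $s\ge1$. -/

import Mathlib

/-- Formal pseudo-differential operators `∑_{n ≤ N} a_n D ^ n` with coefficients in the commutative
ring `R`, where `D` is the symbol of the derivation `δ` of `R`. -/
@[ext]
structure PDO {R : Type*} [CommRing R] [Algebra ℚ R] (δ : Derivation ℚ R R) where
  /-- The coefficient of `D ^ n`. -/
  coeff : ℤ → R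
  bdd : ∃ N : ℤ, ∀ n, N < n → coeff n = 0

namespace PDO

open Finset

variable {R : Type*} [CommRing R] [Algebra ℚ R] {δ : Derivation ℚ R R}

theorem iterate_leibniz (δ : Derivation ℚ R R) (n : ℕ) (a b : R) :
    δ^[n] (a * b) = ∑ x ∈ antidiagonal n, Nat.choose n x.1 • (δ^[x.1] a * δ^[x.2] b) := by
  induction n with
  | zero => simp
  | succ n ih =>
    rw [sum_antidiagonal_choose_succ_nsmul (M := R) (fun i j => (δ^[i] a * δ^[j] b)) n]
    simp only [Function.iterate_succ_apply', ih, map_sum, map_nsmul, Derivation.leibniz, smul_add,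
      sum_add_distrib, add_right_inj, smul_eq_mul]
    refine sum_congr rfl fun x hij ↦ ?_
    rw [n.choose_symm_of_eq_add (mem_antidiagonal.1 hij).symm, mul_comm]

theorem iterate_eq_zero (δ : Derivation ℚ R R) (n : ℕ) : δ^[n] (0 : R) = 0 :=
  iterate_map_zero δ n

theorem antidiagonal_identity (δ : Derivation ℚ R R) (i j : ℤ) (b c : R) (T : ℕ) :
    ∑ x ∈ antidiagonal T,
      ((Ring.choose i x.1 : ℤ) : R) * ((Ring.choose j x.2 : ℤ) : R) * δ^[x.1] (b * δ^[x.2] c)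
    = ∑ x ∈ antidiagonal T, ((Ring.choose i x.1 : ℤ) : R) *
        ((Ring.choose (i + j - x.1) x.2 : ℤ) : R) * (δ^[x.1] b * δ^[x.2] c) := by
  have h1 : ∀ x ∈ antidiagonal T,
      ((Ring.choose i x.1 : ℤ) : R) * ((Ring.choose j x.2 : ℤ) : R) * δ^[x.1] (b * δ^[x.2] c)
      = ∑ y ∈ antidiagonal x.1, ((Ring.choose i y.1 : ℤ) : R) *
          ((Ring.choose (i - y.1) y.2 : ℤ) : R) * ((Ring.choose j x.2 : ℤ) : R) *
          (δ^[y.1] b * δ^[y.2 + x.2] c) := by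
    intro x _
    rw [iterate_leibniz, mul_sum]
    refine sum_congr rfl fun y hy ↦ ?_
    have hy' := mem_antidiagonal.1 hy
    have := Ring.choose_smul_choose i (n := x.1) (k := y.1) (by omega)
    rw [show x.1 - y.1 = y.2 by omega] at this
    have t2 := congrArg (Int.cast : ℤ → R) this
    push_cast [nsmul_eq_mul] at t2
    rw [← Function.iterate_add_apply, nsmul_eq_mul]
    linear_combination ((Ring.choose j x.2 : ℤ) : R) * (δ^[y.1] b * δ^[y.2 + x.2] c) * t2
  have h2 : ∀ x ∈ antidiagonal T, ((Ring.choose i x.1 : ℤ) : R) *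
        ((Ring.choose (i + j - x.1) x.2 : ℤ) : R) * (δ^[x.1] b * δ^[x.2] c)
      = ∑ y ∈ antidiagonal x.2, ((Ring.choose i x.1 : ℤ) : R) *
          ((Ring.choose (i - x.1) y.1 : ℤ) : R) * ((Ring.choose j y.2 : ℤ) : R) *
          (δ^[x.1] b * δ^[y.1 + y.2] c) := by
    intro x _
    have := Ring.add_choose_eq x.2 (Commute.all (i - x.1) j)
    rw [show i - x.1 + j = i + j - x.1 by ring] at this
    rw [this]
    push_cast
    rw [mul_sum, sum_mul]
    refine sum_congr rfl fun y hy ↦ ?_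
    rw [mem_antidiagonal.1 hy]
    ring
  rw [sum_congr rfl h1, sum_congr rfl h2, sum_sigma', sum_sigma']
  apply sum_nbij' (fun ⟨⟨_i, j⟩, ⟨k, l⟩⟩ ↦ ⟨(k, l + j), (l, j)⟩)
    (fun ⟨⟨i, _j⟩, ⟨k, l⟩⟩ ↦ ⟨(i + k, l), (i, k)⟩) <;>
    simp +contextual [add_assoc, mul_assoc]
  rintro ⟨⟨a, b⟩, ⟨c, d⟩⟩ h h'
  simp only at h h' ⊢
  omega

theorem finsum_eq_of_antidiagonal {R : Type*} [AddCommMonoid R] (f g : ℕ × ℕ → R) (K : ℕ)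
    (hf : ∀ x, K ≤ x.1 + x.2 → f x = 0) (hg : ∀ x, K ≤ x.1 + x.2 → g x = 0)
    (h : ∀ T, ∑ x ∈ antidiagonal T, f x = ∑ x ∈ antidiagonal T, g x) :
    ∑ᶠ x, f x = ∑ᶠ x, g x := by
  have key : ∀ f : ℕ × ℕ → R, (∀ x, K ≤ x.1 + x.2 → f x = 0) →
      ∑ᶠ x, f x = ∑ T ∈ range K, ∑ x ∈ antidiagonal T, f x := by
    intro f hf
    rw [sum_sigma', ← sum_image (s := (range K).sigma fun T => antidiagonal T)
      (g := fun y : (_ : ℕ) × ℕ × ℕ => y.2)]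
    · apply finsum_eq_sum_of_support_subset
      intro x hx
      have : x.1 + x.2 < K := by
        by_contra hc
        exact hx (hf x (by omega))
      simp only [coe_image, Set.mem_image]
      exact ⟨⟨x.1 + x.2, x⟩, by simp [this], rfl⟩
    · rintro ⟨a, x⟩ hx ⟨b, y⟩ hy hxy
      simp at hx hy hxy
      subst hxy
      obtain ⟨_, rfl⟩ := hx
      obtain ⟨_, rfl⟩ := hy
      rfl
  rw [key f hf, key g hg, sum_congr rfl fun T _ => h T]

instance : Zero (PDO δ) := ⟨⟨fun _ => 0, 0, fun _ _ => rfl⟩⟩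

instance : Add (PDO δ) := ⟨fun A B => ⟨fun n => A.coeff n + B.coeff n, by
  obtain ⟨N, hN⟩ := A.bdd
  obtain ⟨M, hM⟩ := B.bdd
  refine ⟨max N M, fun n hn => ?_⟩
  rw [hN n (lt_of_le_of_lt (le_max_left _ _) hn), hM n (lt_of_le_of_lt (le_max_right _ _) hn),
    add_zero]⟩⟩

instance : Neg (PDO δ) := ⟨fun A => ⟨fun n => -A.coeff n, by
  obtain ⟨N, hN⟩ := A.bdd
  exact ⟨N, fun n hn => by rw [hN n hn, neg_zero]⟩⟩⟩

/-- The operator `a D ^ n`. -/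
def monomial (δ : Derivation ℚ R R) (n : ℤ) (a : R) : PDO δ :=
  ⟨fun m => if m = n then a else 0, n, fun m hm => if_neg (by omega)⟩

/-- The operator of multiplication by the function `a`. -/
def C (δ : Derivation ℚ R R) (a : R) : PDO δ := monomial δ 0 a

/-- The operator `D ^ n`, for an integer `n`. -/
def D (δ : Derivation ℚ R R) (n : ℤ) : PDO δ := monomial δ n 1

instance : One (PDO δ) := ⟨C δ 1⟩

theorem mulTerm_support (A B : PDO δ) : ∃ N M : ℤ, ∀ (n i : ℤ) (k : ℕ),
    A.coeff i * δ^[k] (B.coeff (n - i + k)) ≠ 0 → i ≤ N ∧ n - i + k ≤ M := by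
  obtain ⟨N, hN⟩ := A.bdd
  obtain ⟨M, hM⟩ := B.bdd
  refine ⟨N, M, fun n i k h => ⟨?_, ?_⟩⟩
  · by_contra hc
    exact h (by rw [hN i (by omega), zero_mul])
  · by_contra hc
    exact h (by rw [hM _ (by omega), iterate_eq_zero, mul_zero])

/-- The product determined by `a D ^ i * b D ^ j = ∑_{k ≥ 0} (i choose k) a (δ ^ k b) D ^ (i+j-k)`;
all sums are finite. -/
noncomputable instance : Mul (PDO δ) := ⟨fun A B => ⟨fun n => ∑ᶠ p : ℤ × ℕ,
    ((Ring.choose p.1 p.2 : ℤ) : R) * (A.coeff p.1 * δ^[p.2] (B.coeff (n - p.1 + p.2))), by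
  obtain ⟨N, M, h⟩ := mulTerm_support A B
  refine ⟨N + M, fun n hn => ?_⟩
  rw [← finsum_zero (α := ℤ × ℕ)]
  refine finsum_congr fun p => ?_
  by_contra hc
  have := h n p.1 p.2 (fun h0 => hc (by rw [h0, mul_zero]))
  omega⟩⟩

@[simp] theorem coeff_zero (n : ℤ) : (0 : PDO δ).coeff n = 0 := rfl
@[simp] theorem coeff_add (A B : PDO δ) (n : ℤ) : (A + B).coeff n = A.coeff n + B.coeff n := rfl
@[simp] theorem coeff_neg (A : PDO δ) (n : ℤ) : (-A).coeff n = -A.coeff n := rfl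
theorem coeff_monomial (m n : ℤ) (a : R) :
    (monomial δ n a).coeff m = if m = n then a else 0 := rfl
theorem coeff_one (n : ℤ) : (1 : PDO δ).coeff n = if n = 0 then 1 else 0 := rfl
theorem coeff_mul (A B : PDO δ) (n : ℤ) : (A * B).coeff n = ∑ᶠ p : ℤ × ℕ,
    ((Ring.choose p.1 p.2 : ℤ) : R) * (A.coeff p.1 * δ^[p.2] (B.coeff (n - p.1 + p.2))) := rfl

theorem mul_finite (A B : PDO δ) (n : ℤ) : (fun p : ℤ × ℕ => ((Ring.choose p.1 p.2 : ℤ) : R) *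
    (A.coeff p.1 * δ^[p.2] (B.coeff (n - p.1 + p.2)))).HasFiniteSupport := by
  obtain ⟨N, M, h⟩ := mulTerm_support A B
  refine ((Set.finite_Icc (n - M) N).prod (Set.finite_Icc 0 (M + N - n).toNat)).subset ?_
  intro p hp
  have := h n p.1 p.2 (fun h0 => hp (by simp only [h0, mul_zero]))
  simp only [Set.mem_prod, Set.mem_Icc]
  omega

theorem coeff_mul_assoc (A B E : PDO δ) (n : ℤ) :
    ((A * B) * E).coeff n = (A * (B * E)).coeff n := by
  obtain ⟨NA, hA⟩ := A.bdd
  obtain ⟨NB, hB⟩ := B.bdd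
  obtain ⟨NE, hE⟩ := E.bdd
  -- the common index set: `((i, j), (r, k))`
  let f : (ℤ × ℤ) × (ℕ × ℕ) → R := fun x =>
    A.coeff x.1.1 * (((Ring.choose x.1.1 x.2.1 : ℤ) : R) *
      ((Ring.choose (x.1.1 + x.1.2 - x.2.1) x.2.2 : ℤ) : R) *
      (δ^[x.2.1] (B.coeff x.1.2) *
        δ^[x.2.2] (E.coeff (n - x.1.1 - x.1.2 + (x.2.1 + x.2.2 : ℕ)))))
  let g : (ℤ × ℤ) × (ℕ × ℕ) → R := fun x =>
    A.coeff x.1.1 * (((Ring.choose x.1.1 x.2.1 : ℤ) : R) * ((Ring.choose x.1.2 x.2.2 : ℤ) : R) *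
      δ^[x.2.1] (B.coeff x.1.2 *
        δ^[x.2.2] (E.coeff (n - x.1.1 - x.1.2 + (x.2.1 + x.2.2 : ℕ)))))
  have box : ((Set.Icc (n - NB - NE) NA ×ˢ Set.Icc (n - NA - NE) NB) ×ˢ
      (Set.Icc 0 (NA + NB + NE - n).toNat ×ˢ Set.Icc 0 (NA + NB + NE - n).toNat) :
      Set ((ℤ × ℤ) × (ℕ × ℕ))).Finite :=
    ((Set.finite_Icc _ _).prod (Set.finite_Icc _ _)).prod
      ((Set.finite_Icc _ _).prod (Set.finite_Icc _ _))
  have hf0 : ∀ x : (ℤ × ℤ) × (ℕ × ℕ), f x ≠ 0 →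
      x.1.1 ≤ NA ∧ x.1.2 ≤ NB ∧ n - x.1.1 - x.1.2 + (x.2.1 + x.2.2 : ℕ) ≤ NE := by
    intro x hx
    refine ⟨?_, ?_, ?_⟩ <;> by_contra hc <;> apply hx
    · simp only [f]; rw [hA _ (by omega), zero_mul]
    · simp only [f]; rw [hB _ (by omega), iterate_eq_zero]; ring
    · simp only [f]; rw [hE _ (by omega), iterate_eq_zero δ x.2.2]; ring
  have hg0 : ∀ x : (ℤ × ℤ) × (ℕ × ℕ), g x ≠ 0 →
      x.1.1 ≤ NA ∧ x.1.2 ≤ NB ∧ n - x.1.1 - x.1.2 + (x.2.1 + x.2.2 : ℕ) ≤ NE := by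
    intro x hx
    refine ⟨?_, ?_, ?_⟩ <;> by_contra hc <;> apply hx
    · simp only [g]; rw [hA _ (by omega), zero_mul]
    · simp only [g]; rw [hB _ (by omega), zero_mul, iterate_eq_zero]; ring
    · simp only [g]; rw [hE _ (by omega), iterate_eq_zero δ x.2.2, mul_zero, iterate_eq_zero]; ring
  have hf : f.HasFiniteSupport := by
    refine box.subset fun x hx => ?_
    have := hf0 x hx
    simp only [Set.mem_prod, Set.mem_Icc]
    omega
  have hg : g.HasFiniteSupport := by
    refine box.subset fun x hx => ?_
    have := hg0 x hx
    simp only [Set.mem_prod, Set.mem_Icc]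
    omega
  have hL : ((A * B) * E).coeff n = ∑ᶠ x, f x := by
    let e : (ℤ × ℕ) × (ℤ × ℕ) ≃ (ℤ × ℤ) × (ℕ × ℕ) :=
      { toFun := fun y => ((y.2.1, y.1.1 - y.2.1 + y.2.2), (y.2.2, y.1.2))
        invFun := fun x => ((x.1.1 + x.1.2 - x.2.1, x.2.2), (x.1.1, x.2.1))
        left_inv := by rintro ⟨⟨m, k⟩, ⟨i, r⟩⟩; simp; ring
        right_inv := by rintro ⟨⟨i, j⟩, ⟨r, k⟩⟩; simp; ring }
    have hfe : (fun y => f (e y)).HasFiniteSupport :=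
      (Set.Finite.preimage e.injective.injOn hf : _)
    rw [← finsum_comp_equiv e, finsum_curry _ hfe, coeff_mul]
    refine finsum_congr fun p => ?_
    rw [coeff_mul, finsum_mul' _ _ (mul_finite A B p.1), mul_finsum']
    · refine finsum_congr fun q => ?_
      simp only [f, e, Equiv.coe_fn_mk]
      rw [show n - q.1 - (p.1 - q.1 + q.2) + (q.2 + p.2 : ℕ) = n - p.1 + p.2 by push_cast; ring,
        show q.1 + (p.1 - q.1 + q.2) - q.2 = p.1 by ring]
      ring
    · refine (mul_finite A B p.1).subset fun q hq h0 => hq ?_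
      simp only at h0 ⊢
      rw [h0, zero_mul]
  have hR : (A * (B * E)).coeff n = ∑ᶠ x, g x := by
    let e := Equiv.prodProdProdComm ℤ ℕ ℤ ℕ
    have hge : (fun y => g (e y)).HasFiniteSupport :=
      (Set.Finite.preimage e.injective.injOn hg : _)
    rw [← finsum_comp_equiv e, finsum_curry _ hge, coeff_mul]
    refine finsum_congr fun p => ?_
    have hfin := mul_finite B E (n - p.1 + p.2)
    have hit : ∀ x : R, δ^[p.2] x = ((δ : R →ₗ[ℚ] R) ^ p.2) x := fun x => by
      rw [Module.End.pow_apply]; rfl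
    rw [coeff_mul, hit, map_finsum _ hfin, mul_finsum', mul_finsum']
    · refine finsum_congr fun q => ?_
      simp only [g, e, Equiv.prodProdProdComm_apply]
      rw [← hit, show n - p.1 + p.2 - q.1 + q.2 = n - p.1 - q.1 + (p.2 + q.2 : ℕ) by
        push_cast; ring, ← zsmul_eq_mul (a := B.coeff q.1 * _), hit (Ring.choose q.1 q.2 • _), map_zsmul,
        ← hit, zsmul_eq_mul]
      ring
    · refine hfin.subset fun q hq h0 => hq ?_
      simp only at h0 ⊢
      rw [h0, map_zero, mul_zero]
    · refine hfin.subset fun q hq h0 => hq ?_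
      simp only at h0 ⊢
      rw [h0, map_zero]
  rw [hL, hR, finsum_curry _ hf, finsum_curry _ hg]
  refine finsum_congr fun ij => ?_
  apply finsum_eq_of_antidiagonal _ _ ((NE - n + ij.1 + ij.2).toNat + 1)
  · intro x hx
    by_contra hc
    have := hf0 (ij, x) hc
    simp only at this
    omega
  · intro x hx
    by_contra hc
    have := hg0 (ij, x) hc
    simp only at this
    omega
  · intro T
    simp only [f, g]
    rw [← mul_sum, ← mul_sum]
    congr 1
    have hT : ∀ x ∈ antidiagonal T, (x.1 + x.2 : ℕ) = T := fun x hx => mem_antidiagonal.1 hx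
    rw [sum_congr rfl fun x hx => by rw [hT x hx]]
    conv_rhs => rw [sum_congr rfl fun x hx => by rw [hT x hx]]
    exact (antidiagonal_identity δ _ _ _ _ T).symm

noncomputable instance : Ring (PDO δ) where
  add_assoc A B E := by ext; simp [add_assoc]
  zero_add A := by ext; simp
  add_zero A := by ext; simp
  add_comm A B := by ext; simp [add_comm]
  neg_add_cancel A := by ext; simp
  nsmul := nsmulRec
  zsmul := zsmulRec
  mul_assoc A B E := by ext; exact coeff_mul_assoc A B E _
  one_mul A := by
    ext n
    rw [coeff_mul, finsum_eq_single _ ((0 : ℤ), 0)]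
    · simp [coeff_one]
    · rintro ⟨i, k⟩ h
      by_cases hi : i = 0
      · subst hi
        have : 0 < k := Nat.pos_of_ne_zero fun hk => h (by rw [hk])
        simp [Ring.choose_zero_pos ℤ this]
      · simp [coeff_one, hi]
  mul_one A := by
    ext n
    rw [coeff_mul, finsum_eq_single _ ((n : ℤ), 0)]
    · simp [coeff_one]
    · rintro ⟨i, k⟩ h
      by_cases hk : k = 0
      · subst hk
        have : n - i ≠ 0 := fun hi => h (by rw [show i = n by omega])
        simp [coeff_one, this]
      · obtain ⟨k, rfl⟩ := Nat.exists_eq_succ_of_ne_zero hk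
        simp only [coeff_one, Function.iterate_succ_apply]
        split_ifs <;> simp
  left_distrib A B E := by
    ext n
    simp only [coeff_add, coeff_mul]
    rw [← finsum_add_distrib (mul_finite A B n) (mul_finite A E n)]
    refine finsum_congr fun p => ?_
    rw [iterate_map_add δ]
    ring
  right_distrib A B E := by
    ext n
    simp only [coeff_add, coeff_mul]
    rw [← finsum_add_distrib (mul_finite A E n) (mul_finite B E n)]
    refine finsum_congr fun p => ?_
    ring
  zero_mul A := by ext; simp [coeff_mul]
  mul_zero A := by ext; simp [coeff_mul]

/-- The operator `∑_{s ≥ 1} a_s D ^ (-s)`. -/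
def lowerSeries (δ : Derivation ℚ R R) (a : ℕ → R) : PDO δ :=
  ⟨fun n => if n < 0 then a (-n).toNat else 0, 0, fun n hn => if_neg (by omega)⟩

/-- The purely differential part `A₊ = ∑_{n ≥ 0} a_n D ^ n`. -/
def posPart (A : PDO δ) : PDO δ :=
  ⟨fun n => if 0 ≤ n then A.coeff n else 0, by
    obtain ⟨N, hN⟩ := A.bdd
    exact ⟨N, fun n hn => by rw [hN n hn, ite_self]⟩⟩

/-- The purely pseudo-differential part `A₋ = ∑_{n ≥ 1} a_{-n} D ^ (-n)`. -/
def negPart (A : PDO δ) : PDO δ :=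
  ⟨fun n => if n < 0 then A.coeff n else 0, 0, fun n hn => if_neg (by omega)⟩

/-- A derivation `d` of `R` applied to all coefficients of an operator. -/
def mapCoeff (d : Derivation ℚ R R) (A : PDO δ) : PDO δ :=
  ⟨fun n => d (A.coeff n), by
    obtain ⟨N, hN⟩ := A.bdd
    exact ⟨N, fun n hn => by rw [hN n hn, map_zero]⟩⟩

/-- The action `A₊(f) = ∑_{k ≥ 0} a_k δ ^ k f` on a function `f` of the differential part of `A`. -/
noncomputable def posAct (A : PDO δ) (f : R) : R := ∑ᶠ k : ℕ, A.coeff k * δ^[k] f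

/-- The formal adjoint, determined by
`(a D ^ m)^* = (-1) ^ m D ^ m a = (-1) ^ m ∑_{k ≥ 0} (m choose k) (δ ^ k a) D ^ (m-k)`. -/
noncomputable def adjoint (A : PDO δ) : PDO δ :=
  ⟨fun n => ∑ᶠ k : ℕ, (((n + k).negOnePow : ℤ) : R) * ((Ring.choose (n + k) k : ℤ) : R) *
      δ^[k] (A.coeff (n + k)), by
    obtain ⟨N, hN⟩ := A.bdd
    refine ⟨N, fun n hn => ?_⟩
    rw [← finsum_zero (α := ℕ)]
    refine finsum_congr fun k => ?_
    rw [hN (n + k) (by omega), iterate_eq_zero, mul_zero]⟩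

/-- The operators of the form `D + ∑_{i ≥ 1} u_i D ^ (-i)`. -/
def IsKPForm (A : PDO δ) : Prop := ∃ u : ℕ → R, A = D δ 1 + lowerSeries δ u

end PDO

namespace GhostKP

open PDO Finset

variable {R : Type*} [CommRing R] [Algebra ℚ R]

/-- The logarithmic derivative `d (ln f) = (d f) / f` of an invertible `f`. -/
noncomputable def dlog (d : Derivation ℚ R R) (f : R) : R := d f * Ring.inverse f

/-- The Wronskian `det ‖δ ^ (α-1) f_β‖`, `α, β = 1, …, k`. -/
def wronskian (δ : Derivation ℚ R R) {k : ℕ} (f : Fin k → R) : R :=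
  Matrix.det (Matrix.of fun α β : Fin k => δ^[(α : ℕ)] (f β))

/-- The Wronskian of the first `k` members `f_1, …, f_k` of a sequence indexed from `1`. -/
def wr (δ : Derivation ℚ R R) (f : ℕ → R) (k : ℕ) : R :=
  wronskian δ fun β : Fin k => f (β + 1)

/-- The Wronskian of `f_1, …, f_k, F`. -/
def wrSnoc (δ : Derivation ℚ R R) (f : ℕ → R) (k : ℕ) (F : R) : R :=
  wronskian δ (Fin.snoc (α := fun _ => R) (fun β : Fin k => f (β + 1)) F)

/-- The ghost symmetry generator `M_s = ∑_{j=1}^s Φ_{s-j+1} D⁻¹ Ψ_j`. -/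
noncomputable def ghostGen (δ : Derivation ℚ R R) (Φ Ψ : ℕ → R) (s : ℕ) : PDO δ :=
  ∑ j ∈ Icc 1 s, C δ (Φ (s - j + 1)) * D δ (-1) * C δ (Ψ j)

/-- A solution of the KP hierarchy with an infinite set of ghost symmetries.

* `R` is the algebra of functions of the times `t_1 = x, t_2, …` and `t̄_1, t̄_2, …`, with the
  partial derivatives `t l = ∂/∂t_l` and `tb s = ∂/∂t̄_s` (`l, s ≥ 1`; the values at index `0`
  of all sequences are irrelevant).
* `L` is the Lax operator, `Φ k` and `Ψ k` (`k ≥ 1`) are the (adjoint) eigenfunctions generating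
  the ghost flows.
* `S k j` is the function written `∂⁻¹ (Φ_k Ψ_j)` in the ghost flows. -/
structure IsSystem (t tb : ℕ → Derivation ℚ R R) (L : PDO (t 1)) (Φ Ψ : ℕ → R)
    (S : ℕ → ℕ → R) : Prop where
  comm_t : ∀ l m f, 1 ≤ l → 1 ≤ m → t l (t m f) = t m (t l f)
  comm_t_tb : ∀ l s f, 1 ≤ l → 1 ≤ s → t l (tb s f) = tb s (t l f)
  comm_tb : ∀ r s f, 1 ≤ r → 1 ≤ s → tb r (tb s f) = tb s (tb r f)
  kpForm : IsKPForm L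
  lax : ∀ l, 1 ≤ l → mapCoeff (t l) L = posPart (L ^ l) * L - L * posPart (L ^ l)
  eigen : ∀ l k, 1 ≤ l → 1 ≤ k → t l (Φ k) = posAct (L ^ l) (Φ k)
  adjEigen : ∀ l k, 1 ≤ l → 1 ≤ k → t l (Ψ k) = -posAct (adjoint L ^ l) (Ψ k)
  potential : ∀ k j, 1 ≤ k → 1 ≤ j → t 1 (S k j) = Φ k * Ψ j
  ghost_L : ∀ s, 1 ≤ s →
    mapCoeff (tb s) L = ghostGen (t 1) Φ Ψ s * L - L * ghostGen (t 1) Φ Ψ s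
  ghost_Φ : ∀ s k, 1 ≤ s → 1 ≤ k →
    tb s (Φ k) = ∑ j ∈ Icc 1 s, Φ (s - j + 1) * S k j - Φ (k + s)
  ghost_Ψ : ∀ s k, 1 ≤ s → 1 ≤ k →
    tb s (Ψ k) = ∑ j ∈ Icc 1 s, Ψ j * S (s - j + 1) k + Ψ (k + s)
  /-- Independence of the `Φ_k`: all Wronskians can be divided by. -/
  isUnit_wr_Φ : ∀ k, 1 ≤ k → IsUnit (wr (t 1) Φ k)
  /-- Independence of the `Ψ_k`: all Wronskians can be divided by. -/
  isUnit_wr_Ψ : ∀ k, 1 ≤ k → IsUnit (wr (t 1) Ψ k)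

/-- With `𝒲_i` the Wronskian of `Ψ_1, …, Ψ_i` with respect to `x`, the product of the `i + 1`
first-order operators
`(D̄ - ∂̄ ln (𝒲_i / 𝒲_{i-1})) ⋯ (D̄ - ∂̄ ln Ψ_1) (D̄ - ∂̄ ln (1 / Φ_1))`. -/
noncomputable def factors (t tb : ℕ → Derivation ℚ R R) (Φ Ψ : ℕ → R) : ℕ → PDO (tb 1)
  | 0 => D (tb 1) 1 - C (tb 1) (dlog (tb 1) (Ring.inverse (Φ 1)))
  | i + 1 => (D (tb 1) 1 - C (tb 1)
      (dlog (tb 1) (wr (t 1) Ψ (i + 1) * Ring.inverse (wr (t 1) Ψ i)))) * factors t tb Φ Ψ i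

/-- The `∂̄`-differential operator
`M̄_s = ∑_{j=1}^s (∑_{k=j}^s (Φ_{s-k+1} / Φ_1) 𝒲_{j-1}(Ψ_k) / 𝒲_j)
  (D̄ - ∂̄ ln (𝒲_{j-1} / 𝒲_{j-2})) ⋯ (D̄ - ∂̄ ln Ψ_1) (D̄ - ∂̄ ln (1 / Φ_1)) - ∂ (ln Φ_1) / ∂t̄_s`. -/
noncomputable def Mbar (t tb : ℕ → Derivation ℚ R R) (Φ Ψ : ℕ → R) (s : ℕ) : PDO (tb 1) :=
  ∑ j ∈ Icc 1 s, C (tb 1) (∑ k ∈ Icc j s, Φ (s - k + 1) * Ring.inverse (Φ 1) *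
      (wrSnoc (t 1) Ψ (j - 1) (Ψ k) * Ring.inverse (wr (t 1) Ψ j))) * factors t tb Φ Ψ (j - 1)
    - C (tb 1) (dlog (tb s) (Φ 1))

/-- With `W_i` the Wronskian of `Φ_1, …, Φ_i` with respect to `x`, the product of `k` inverses
`(D̄ + ∂̄ ln (W_{k+1} / W_k))⁻¹ ⋯ (D̄ + ∂̄ ln (W_2 / Φ_1))⁻¹`. -/
noncomputable def invFactors (t tb : ℕ → Derivation ℚ R R) (Φ : ℕ → R) : ℕ → PDO (tb 1)
  | 0 => 1
  | k + 1 => Ring.inverse (D (tb 1) 1 + C (tb 1)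
      (dlog (tb 1) (wr (t 1) Φ (k + 2) * Ring.inverse (wr (t 1) Φ (k + 1))))) * invFactors t tb Φ k

/-- `A = D̄ + ∑_{k ≥ 1} b_k (D̄ + ∂̄ ln (W_{k+1} / W_k))⁻¹ ⋯ (D̄ + ∂̄ ln (W_2 / Φ_1))⁻¹` with
`b_1 = -∂̄ (Φ_2 / Φ_1)`. The `k`-th summand has order at most `-k`, so that only `k ≤ -n`
contribute to the coefficient of `D̄ ^ n`. -/
def HasExpansion (t tb : ℕ → Derivation ℚ R R) (Φ : ℕ → R) (A : PDO (tb 1)) : Prop :=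
  ∃ b : ℕ → R, b 1 = -tb 1 (Φ 2 * Ring.inverse (Φ 1)) ∧
    ∀ n : ℤ, A.coeff n = (D (tb 1) 1).coeff n +
      ∑ k ∈ Icc 1 (-n).toNat, (C (tb 1) (b k) * invFactors t tb Φ k).coeff n

/-- `A` is the Lax operator of the ghost flows: it is of KP form and `M̄_s = (A ^ s)₊` for all
`s ≥ 1`. -/
def IsGhostLax (t tb : ℕ → Derivation ℚ R R) (Φ Ψ : ℕ → R) (A : PDO (tb 1)) : Prop :=
  IsKPForm A ∧ ∀ s, 1 ≤ s → Mbar t tb Φ Ψ s = posPart (A ^ s)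

/-- The operator `W̄ = 1 + ∑_{s ≥ 1} (Φ_{s+1} / Φ_1) D̄ ^ (-s)`. -/
noncomputable def Wbar (tb : ℕ → Derivation ℚ R R) (Φ : ℕ → R) : PDO (tb 1) :=
  1 + lowerSeries (tb 1) fun s => Φ (s + 1) * Ring.inverse (Φ 1)

end GhostKP

/-! Write $S_{kj}=\partial^{-1}(\Phi_k\Psi_j)$ and $Y_j=\bar D^j+\sum_{k\ge1}S_{kj}\bar D^{1-k}$.
Read coefficientwise, the ghost flows of the $\Phi_k$ say that $\partial_{\bar t_s}\bar W+\bar W\bar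
D^s=\sum_{j\le s}(\Phi_{s-j+1}/\Phi_1)Y_j-(\partial_{\bar t_s}\ln\Phi_1)\bar W$. The goal is to
rewrite the right side as $\bar M_s\bar W$, so each $Y_k$ must become a differential operator times
$\bar W$.

The start is $(\bar D+\bar\partial\ln\Phi_1)\bar W=Y_1$. Next, $\bar DY_j=Y_{j+1}+S_{1j}Y_1$, which
needs the $\bar t_1$-flow of $S_{kj}$ without an integration constant. The potentials are given only
up to $x$-constants; commutativity of the ghost flows on $\Phi_k$ and independence of the $\Phi$'s
kill these constants (`IsSystem.potentialDefect_one`).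

The functions $\Psi_j$ satisfy the same recursion, $\bar\partial\Psi_j=\Psi_{j+1}+S_{1j}\Psi_1$.
Gaussian elimination on the $Y_k$, with ratios of iterated $x$-Darboux transforms of the $\Psi_k$ as
multipliers, therefore preserves the shape of both recursions (`IsSystem.evolution`). Its pivots are
the products of first-order factors applied to $\bar W$ (`IsSystem.reducedOp_diag`), and Crum's
formula turns the Darboux transforms into Wronskian quotients. The result is $\bar M_s\bar
W=\partial_{\bar t_s}\bar W+\bar W\bar D^s$ (`IsSystem.Mbar_mul_Wbar`).

With $\bar{\mathcal L}=\bar W\bar D\bar W^{-1}$ this reads $\bar M_s-\bar{\mathcal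
L}^s=(\partial_{\bar t_s}\bar W)\bar W^{-1}$, of negative order, while $\bar M_s$ is differential;
hence $\bar M_s=(\bar{\mathcal L}^s)_+$ and the evolution of $\bar W$. Uniqueness compares leading
terms of powers (`IsKPForm.eq_of_posPart_pow`); the expansion is a unitriangular recursion
(`exists_expansion`). -/

namespace PDO

open Finset

variable {R : Type*} [CommRing R] [Algebra ℚ R] {δ : Derivation ℚ R R}

/-! ### Coefficient calculus for pseudo-differential operators -/

@[simp] theorem coeff_sub (A B : PDO δ) (n : ℤ) : (A - B).coeff n = A.coeff n - B.coeff n := by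
  rw [sub_eq_add_neg, coeff_add, coeff_neg, sub_eq_add_neg]

theorem coeff_sum {ι : Type*} (s : Finset ι) (f : ι → PDO δ) (n : ℤ) :
    (∑ i ∈ s, f i).coeff n = ∑ i ∈ s, (f i).coeff n := by
  classical
  induction s using Finset.induction_on with
  | empty => simp
  | insert a s ha ih => rw [sum_insert ha, sum_insert ha, coeff_add, ih]

theorem coeff_D (m n : ℤ) : (D δ m).coeff n = if n = m then 1 else 0 := rfl

theorem coeff_lowerSeries (a : ℕ → R) (n : ℤ) :
    (lowerSeries δ a).coeff n = if n < 0 then a (-n).toNat else 0 := rfl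

theorem coeff_posPart (A : PDO δ) (n : ℤ) :
    (posPart A).coeff n = if 0 ≤ n then A.coeff n else 0 := rfl

theorem coeff_negPart (A : PDO δ) (n : ℤ) :
    (negPart A).coeff n = if n < 0 then A.coeff n else 0 := rfl

theorem coeff_mapCoeff (d : Derivation ℚ R R) (A : PDO δ) (n : ℤ) :
    (mapCoeff d A).coeff n = d (A.coeff n) := rfl

@[simp] theorem coeff_C_mul (a : R) (A : PDO δ) (n : ℤ) :
    (C δ a * A).coeff n = a * A.coeff n := by
  rw [coeff_mul, finsum_eq_single _ ((0 : ℤ), 0)]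
  · simp [C, coeff_monomial]
  · rintro ⟨i, k⟩ h
    by_cases hi : i = 0
    · subst hi
      have : 0 < k := Nat.pos_of_ne_zero fun hk => h (by rw [hk])
      simp [Ring.choose_zero_pos ℤ this]
    · simp [C, coeff_monomial, hi]

@[simp] theorem coeff_mul_D (A : PDO δ) (m n : ℤ) :
    (A * D δ m).coeff n = A.coeff (n - m) := by
  rw [coeff_mul, finsum_eq_single _ ((n - m : ℤ), 0)]
  · simp [coeff_D]
  · rintro ⟨i, k⟩ h
    by_cases hk : k = 0
    · subst hk
      have : n - i ≠ m := fun hi => h (by rw [show i = n - m by omega])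
      simp [coeff_D, this]
    · obtain ⟨k, rfl⟩ := Nat.exists_eq_succ_of_ne_zero hk
      simp only [coeff_D, Function.iterate_succ_apply]
      split_ifs <;> simp

@[simp] theorem coeff_D_one_mul (A : PDO δ) (n : ℤ) :
    (D δ 1 * A).coeff n = A.coeff (n - 1) + δ (A.coeff n) := by
  have hc : ∀ k : ℕ, Ring.choose (1 : ℤ) k = (Nat.choose 1 k : ℤ) := fun k => by
    rw [← Ring.choose_natCast]; rfl
  rw [coeff_mul, finsum_eq_sum_of_support_subset (s := {((1 : ℤ), 0), ((1 : ℤ), 1)})]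
  · rw [sum_pair (by simp)]
    simp [coeff_D, hc]
  · rintro ⟨i, k⟩ h
    rw [Function.mem_support] at h
    have hi : i = 1 := by
      by_contra hi
      exact h (by simp [coeff_D, hi])
    subst hi
    have hk : k < 2 := by
      by_contra hk
      exact h (by simp [hc, Nat.choose_eq_zero_of_lt (show 1 < k by omega)])
    simp only [coe_insert, coe_singleton, Set.mem_insert_iff, Set.mem_singleton_iff, Prod.mk.injEq,
      true_and]
    omega

theorem C_one : C δ 1 = 1 := rfl

theorem C_add (a b : R) : C δ (a + b) = C δ a + C δ b := by
  ext n
  simp only [C, coeff_add, coeff_monomial]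
  split_ifs <;> simp

theorem C_neg (a : R) : C δ (-a) = -C δ a := by
  ext n
  simp only [C, coeff_neg, coeff_monomial]
  split_ifs <;> simp

theorem D_one_mul_C_mul (a : R) (A : PDO δ) :
    D δ 1 * (C δ a * A) = C δ a * (D δ 1 * A) + C δ (δ a) * A := by
  ext n
  simp only [coeff_D_one_mul, coeff_C_mul, coeff_add, Derivation.leibniz, smul_eq_mul]
  ring

theorem D_one_mul (A : PDO δ) : D δ 1 * A = A * D δ 1 + mapCoeff δ A := by
  ext n
  simp [coeff_mapCoeff]

theorem D_mul_D (m n : ℤ) : D δ m * D δ n = D δ (m + n) := by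
  ext k
  rw [coeff_mul_D, coeff_D, coeff_D]
  simp only [sub_eq_iff_eq_add]

theorem D_zero : D δ 0 = 1 := rfl

theorem posPart_add_negPart (A : PDO δ) : posPart A + negPart A = A := by
  ext n
  rw [coeff_add, coeff_posPart, coeff_negPart]
  split_ifs <;> first | omega | simp

/-! ### Orders, leading coefficients and inverses -/

/-- The operator `A` has order at most `N`. -/
def OrdLE (A : PDO δ) (N : ℤ) : Prop := ∀ n, N < n → A.coeff n = 0

theorem OrdLE.mono {A : PDO δ} {N M : ℤ} (h : OrdLE A N) (hNM : N ≤ M) : OrdLE A M :=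
  fun n hn => h n (by omega)

theorem OrdLE.add {A B : PDO δ} {N : ℤ} (hA : OrdLE A N) (hB : OrdLE B N) : OrdLE (A + B) N :=
  fun n hn => by rw [coeff_add, hA n hn, hB n hn, add_zero]

theorem OrdLE.sub {A B : PDO δ} {N : ℤ} (hA : OrdLE A N) (hB : OrdLE B N) : OrdLE (A - B) N :=
  fun n hn => by rw [coeff_sub, hA n hn, hB n hn, sub_zero]

theorem OrdLE.neg {A : PDO δ} {N : ℤ} (hA : OrdLE A N) : OrdLE (-A) N :=
  fun n hn => by rw [coeff_neg, hA n hn, neg_zero]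

theorem OrdLE.mul {A B : PDO δ} {N M : ℤ} (hA : OrdLE A N) (hB : OrdLE B M) :
    OrdLE (A * B) (N + M) := fun n hn => by
  rw [coeff_mul, ← finsum_zero (α := ℤ × ℕ)]
  refine finsum_congr fun p => ?_
  by_cases h : N < p.1
  · simp [hA _ h]
  · rw [hB _ (by omega), iterate_eq_zero, mul_zero, mul_zero]

/-- Every differentiation lowers the order, so only the undifferentiated product of the two top
terms reaches order `N + M`. -/
theorem OrdLE.coeff_mul {A B : PDO δ} {N M : ℤ} (hA : OrdLE A N) (hB : OrdLE B M) :
    (A * B).coeff (N + M) = A.coeff N * B.coeff M := by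
  rw [PDO.coeff_mul, finsum_eq_single _ (N, 0)]
  · simp
  · rintro ⟨i, k⟩ h
    by_cases hi : N < i
    · simp [hA _ hi]
    · have : i < N ∨ k ≠ 0 := by
        by_contra hc
        push Not at hc
        exact h (by rw [hc.2, show i = N by omega])
      simp only
      rw [hB _ (by omega), iterate_eq_zero, mul_zero, mul_zero]

theorem ordLE_one : OrdLE (1 : PDO δ) 0 := fun n hn => by rw [coeff_one, if_neg (by omega)]

theorem ordLE_C (a : R) : OrdLE (C δ a) 0 := fun n hn => if_neg (by omega)

theorem ordLE_D (m : ℤ) : OrdLE (D δ m) m := fun n hn => if_neg (by omega)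

theorem ordLE_lowerSeries (a : ℕ → R) : OrdLE (lowerSeries δ a) (-1) := fun n hn => by
  rw [coeff_lowerSeries, if_neg (by omega)]

theorem eq_zero_of_forall_ordLE {A : PDO δ} (h : ∀ K : ℕ, OrdLE A (-K)) : A = 0 := by
  ext n
  exact h ((-n).toNat + 1) n (by push_cast; omega)

theorem posPart_eq_self_of_coeff_neg {A : PDO δ} (h : ∀ n < 0, A.coeff n = 0) :
    posPart A = A := by
  ext n
  rw [coeff_posPart]
  split_ifs with hn
  · rfl
  · rw [h n (by omega)]

theorem posPart_eq_of_sub_ordLE {A B : PDO δ} (h : OrdLE (A - B) (-1)) :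
    posPart A = posPart B := by
  ext n
  rw [coeff_posPart, coeff_posPart]
  split_ifs with hn
  · have := h n (by omega)
    rwa [coeff_sub, sub_eq_zero] at this
  · rfl

/-- The operator `A` has the form `D ^ N + ∑_{n < N} a_n D ^ n`. -/
structure IsMonic (A : PDO δ) (N : ℤ) : Prop where
  ordLE : OrdLE A N
  coeff_eq_one : A.coeff N = 1

theorem IsMonic.mul {A B : PDO δ} {N M : ℤ} (hA : IsMonic A N) (hB : IsMonic B M) :
    IsMonic (A * B) (N + M) :=
  ⟨hA.ordLE.mul hB.ordLE, by
    rw [hA.ordLE.coeff_mul hB.ordLE, hA.coeff_eq_one, hB.coeff_eq_one, one_mul]⟩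

theorem isMonic_one : IsMonic (1 : PDO δ) 0 := ⟨ordLE_one, rfl⟩

theorem isMonic_D (m : ℤ) : IsMonic (D δ m) m := ⟨ordLE_D m, if_pos rfl⟩

theorem IsMonic.pow {A : PDO δ} {N : ℤ} (hA : IsMonic A N) (s : ℕ) : IsMonic (A ^ s) (s * N) := by
  induction s with
  | zero => simpa using isMonic_one
  | succ s ih =>
    rw [pow_succ]
    convert ih.mul hA using 1
    push_cast
    ring

theorem exists_inverse_one_sub {X : PDO δ} (hX : OrdLE X (-1)) :
    ∃ B, IsMonic B 0 ∧ (1 - X) * B = 1 ∧ B * (1 - X) = 1 := by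
  have hpow : ∀ k : ℕ, OrdLE (X ^ k) (-k) := fun k => by
    induction k with
    | zero => simpa using ordLE_one
    | succ k ih =>
      rw [pow_succ]
      refine (ih.mul hX).mono ?_
      push_cast
      omega
  -- The geometric series $\sum_k X^k$: since $X^k$ has order at most $-k$, only $k\le-n$
  -- contributes to the coefficient of $D^n$.
  let B : PDO δ := ⟨fun n => ∑ k ∈ range (-n + 1).toNat, (X ^ k).coeff n, 0, fun n hn => by
    rw [show (-n + 1).toNat = 0 by omega]
    simp⟩
  have hB : ∀ K : ℕ, OrdLE (B - ∑ k ∈ range K, X ^ k) (-K) := fun K n hn => by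
    rw [coeff_sub, coeff_sum, sub_eq_zero]
    have : ∀ J : ℕ, -n < J → ∑ k ∈ range J, (X ^ k).coeff n
        = ∑ k ∈ range (-n + 1).toNat, (X ^ k).coeff n := fun J hJ => by
      refine (sum_subset (range_subset_range.2 (by omega)) fun k _ hk => ?_).symm
      rw [mem_range] at hk
      exact hpow k n (by omega)
    exact (this K (by omega)).symm
  have hX' : OrdLE (1 - X) 0 := ordLE_one.sub (hX.mono (by omega))
  refine ⟨B, ⟨by simpa using hB 0, ?_⟩, ?_, ?_⟩
  · simp [B, coeff_one]
  · rw [← sub_eq_zero]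
    refine eq_zero_of_forall_ordLE fun K => ?_
    have : (1 - X) * B - 1 = (1 - X) * (B - ∑ k ∈ range K, X ^ k) - X ^ K := by
      rw [mul_sub, mul_neg_geom_sum]
      abel
    rw [this]
    exact ((hX'.mul (hB K)).mono (by omega)).sub (hpow K)
  · rw [← sub_eq_zero]
    refine eq_zero_of_forall_ordLE fun K => ?_
    have : B * (1 - X) - 1 = (B - ∑ k ∈ range K, X ^ k) * (1 - X) - X ^ K := by
      rw [sub_mul, geom_sum_mul_neg]
      abel
    rw [this]
    exact (((hB K).mul hX').mono (by omega)).sub (hpow K)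

theorem IsMonic.exists_inverse {A : PDO δ} {N : ℤ} (hA : IsMonic A N) :
    ∃ B, IsMonic B (-N) ∧ A * B = 1 ∧ B * A = 1 := by
  -- Normalising by $D^{-N}$ reduces to order zero, where $A D^{-N}=1-X$ with $X$ of negative order.
  have hX : OrdLE (1 - A * D δ (-N)) (-1) := fun n hn => by
    rw [coeff_sub, coeff_mul_D, coeff_one]
    split_ifs with h
    · rw [h, show (0 : ℤ) - -N = N by omega, hA.coeff_eq_one, sub_self]
    · rw [hA.ordLE _ (by omega), sub_zero]
  obtain ⟨B, hB, h1, h2⟩ := exists_inverse_one_sub hX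
  rw [sub_sub_cancel] at h1 h2
  refine ⟨D δ (-N) * B, by simpa using (isMonic_D (-N)).mul hB, by rwa [← mul_assoc], ?_⟩
  have := congrArg (fun T => D δ (-N) * T * D δ N) h2
  simp only [mul_one, D_mul_D, neg_add_cancel, D_zero] at this
  rw [← this]
  simp only [mul_assoc, D_mul_D, neg_add_cancel, D_zero, mul_one]

theorem IsMonic.isUnit {A : PDO δ} {N : ℤ} (hA : IsMonic A N) : IsUnit A := by
  obtain ⟨B, -, h1, h2⟩ := hA.exists_inverse
  exact ⟨⟨A, B, h1, h2⟩, rfl⟩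

theorem IsMonic.inverse {A : PDO δ} {N : ℤ} (hA : IsMonic A N) :
    IsMonic (Ring.inverse A) (-N) := by
  obtain ⟨B, hB, h1, h2⟩ := hA.exists_inverse
  have : Ring.inverse A = B := Ring.inverse_unit (⟨A, B, h1, h2⟩ : (PDO δ)ˣ)
  rwa [this]

theorem isMonic_D_one_add_C (a : R) : IsMonic (D δ 1 + C δ a) 1 :=
  ⟨(ordLE_D 1).add ((ordLE_C a).mono (by omega)), by simp [coeff_D, C, coeff_monomial]⟩

theorem IsKPForm.isMonic {A : PDO δ} (h : IsKPForm A) : IsMonic A 1 := by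
  obtain ⟨u, rfl⟩ := h
  exact ⟨(ordLE_D 1).add ((ordLE_lowerSeries u).mono (by omega)),
    by simp [coeff_D, coeff_lowerSeries]⟩

theorem isKPForm_iff {A : PDO δ} : IsKPForm A ↔ OrdLE (A - D δ 1) (-1) := by
  constructor
  · rintro ⟨u, rfl⟩
    rw [add_sub_cancel_left]
    exact ordLE_lowerSeries u
  · intro h
    refine ⟨fun i => A.coeff (-i), ?_⟩
    ext n
    rw [coeff_add, coeff_lowerSeries]
    split_ifs with hn
    · rw [coeff_D, if_neg (by omega), zero_add]
      congr 1
      omega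
    · have := h n (by omega)
      rw [coeff_sub, sub_eq_zero] at this
      rw [this, add_zero]

/-! ### Recovering an operator from its powers; triangular expansions -/

theorem pow_sub_pow_leading {A B : PDO δ} (hA : IsMonic A 1) (hB : IsMonic B 1) {N : ℤ}
    (h : OrdLE (A - B) N) (n : ℕ) :
    OrdLE (A ^ (n + 1) - B ^ (n + 1)) (n + N) ∧
      (A ^ (n + 1) - B ^ (n + 1)).coeff (n + N) = (n + 1) * (A - B).coeff N := by
  induction n with
  | zero => simpa using h
  | succ n ih =>
    have key : A ^ (n + 2) - B ^ (n + 2)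
        = A * (A ^ (n + 1) - B ^ (n + 1)) + (A - B) * B ^ (n + 1) := by
      rw [pow_succ' A, pow_succ' B]
      noncomm_ring
    have hBn := hB.pow (n + 1)
    have e1 : ((n + 1 : ℕ) : ℤ) + N = 1 + (n + N) := by push_cast; ring
    have e2 : ((n + 1 : ℕ) : ℤ) + N = N + ((n + 1 : ℕ) : ℤ) * 1 := by push_cast; ring
    rw [key]
    constructor
    · refine OrdLE.add ?_ ?_
      · rw [e1]; exact hA.ordLE.mul ih.1
      · rw [e2]; exact h.mul hBn.ordLE
    · rw [coeff_add]
      nth_rewrite 1 [e1]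
      rw [e2, hA.ordLE.coeff_mul ih.1, h.coeff_mul hBn.ordLE, hA.coeff_eq_one, hBn.coeff_eq_one,
        ih.2]
      push_cast
      ring

/-- An operator of KP form is determined by the differential parts of its powers. -/
theorem IsKPForm.eq_of_posPart_pow {A B : PDO δ} (hA : IsKPForm A) (hB : IsKPForm B)
    (h : ∀ s, 1 ≤ s → posPart (A ^ s) = posPart (B ^ s)) : A = B := by
  rw [← sub_eq_zero]
  have step : ∀ K : ℕ, OrdLE (A - B) (-(K + 1 : ℕ)) := fun K => by
    induction K with
    | zero =>
      have := (isKPForm_iff.1 hA).sub (isKPForm_iff.1 hB)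
      simpa using this
    | succ K ih =>
      intro n hn
      rcases eq_or_ne n (-(K + 1 : ℕ)) with rfl | hne
      · have h1 := (pow_sub_pow_leading hA.isMonic hB.isMonic ih (K + 1)).2
        have h2 := congrArg (fun T => T.coeff 0) (h (K + 1 + 1) (by omega))
        simp only [coeff_posPart, le_refl, if_true] at h2
        rw [add_neg_cancel, coeff_sub, h2, sub_self] at h1
        have hu : IsUnit (((K + 1 : ℕ) : R) + 1) := by
          have : ((K + 1 : ℕ) : R) + 1 = algebraMap ℚ R (K + 2) := by
            rw [map_add, map_natCast, map_ofNat]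
            push_cast
            ring
          rw [this]
          exact (IsUnit.mk0 _ (by positivity)).map _
        exact (hu.mul_right_eq_zero).1 h1.symm
      · exact ih n (by push_cast at hn hne ⊢; omega)
  exact eq_zero_of_forall_ordLE fun K => (step K).mono (by push_cast; omega)

/-- An operator of negative order can be expanded along any sequence of monic operators of orders
`-1, -2, …`. -/
theorem exists_expansion {A : PDO δ} (hA : OrdLE A (-1)) {P : ℕ → PDO δ}
    (hP : ∀ k : ℕ, IsMonic (P k) (-k)) : ∃ b : ℕ → R, b 1 = A.coeff (-1) ∧
    ∀ n : ℤ, A.coeff n = ∑ k ∈ Icc 1 (-n).toNat, (C δ (b k) * P k).coeff n := by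
  have hex : ∃ b : ℕ → R, ∀ m : ℕ, b m = A.coeff (-m) -
      ∑ k ∈ Icc 1 (m - 1), b k * (P k).coeff (-m) := by
    -- The coefficient of $D^{-m}$ gives a unitriangular system, as `P m` is monic. The value at
    -- index 0 is a dummy and is kept out of the sum.
    let b : ℕ → R := fun m => Nat.strongRec (motive := fun _ => R) (fun m ih => A.coeff (-m) -
      ∑ k : Fin m, if 1 ≤ (k : ℕ) then ih k k.2 * (P k).coeff (-m) else 0) m
    refine ⟨b, fun m => ?_⟩
    have hb : b m = A.coeff (-m) -
        ∑ k : Fin m, if 1 ≤ (k : ℕ) then b k * (P k).coeff (-m) else 0 := by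
      simp only [b]
      rw [Nat.strongRec_eq]
    rw [hb, Fin.sum_univ_eq_sum_range (fun k => if 1 ≤ k then b k * (P k).coeff (-m) else 0),
      ← sum_filter]
    congr 2
    ext k
    simp only [mem_filter, mem_range, mem_Icc]
    omega
  obtain ⟨b, hb⟩ := hex
  refine ⟨b, by simpa using hb 1, fun n => ?_⟩
  by_cases hn : n < 0
  · obtain ⟨m, rfl⟩ : ∃ m : ℕ, n = -((m + 1 : ℕ) : ℤ) := ⟨(-n).toNat - 1, by omega⟩
    have h1 := hb (m + 1)
    have h2 : (P (m + 1)).coeff (-((m + 1 : ℕ) : ℤ)) = 1 := (hP (m + 1)).coeff_eq_one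
    rw [neg_neg, Int.toNat_natCast, sum_Icc_succ_top (by omega)]
    simp only [coeff_C_mul]
    rw [h2, h1]
    simp
  · rw [hA n (by omega), show (-n).toNat = 0 by omega]
    simp

end PDO

namespace GhostKP

open PDO Finset

variable {R : Type*} [CommRing R] [Algebra ℚ R]

/-! ### Logarithmic derivatives -/

theorem dlog_mul_self (d : Derivation ℚ R R) {f : R} (hf : IsUnit f) : dlog d f * f = d f := by
  rw [dlog, mul_assoc, Ring.inverse_mul_cancel f hf, mul_one]

theorem derivation_inverse (d : Derivation ℚ R R) {f : R} (hf : IsUnit f) :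
    d (Ring.inverse f) = -(d f * Ring.inverse f * Ring.inverse f) := by
  have h1 := Ring.mul_inverse_cancel f hf
  have h2 := congrArg d h1
  rw [Derivation.leibniz, Derivation.map_one_eq_zero, smul_eq_mul, smul_eq_mul] at h2
  linear_combination Ring.inverse f * h2 - d (Ring.inverse f) * h1

theorem dlog_inverse (d : Derivation ℚ R R) {f : R} (hf : IsUnit f) :
    dlog d (Ring.inverse f) = -dlog d f := by
  have h1 := Ring.mul_inverse_cancel f hf
  rw [dlog, Ring.inverse_inverse hf, derivation_inverse d hf, dlog]
  linear_combination -(d f * Ring.inverse f) * h1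

/-! ### Wronskians and iterated Darboux transformations -/

/-- The `j`-fold Darboux transform of `F` along `f_1, …, f_j`: the `j`-th step is
`∂ - ∂ ln θ` where `θ` is the transform of `f_j` by the preceding steps. -/
noncomputable def darboux (δ : Derivation ℚ R R) (f : ℕ → R) : ℕ → R → R
  | 0, F => F
  | j + 1, F => δ (darboux δ f j F) - dlog δ (darboux δ f j (f (j + 1))) * darboux δ f j F

variable (δ : Derivation ℚ R R) (f : ℕ → R)

theorem darboux_succ (j : ℕ) (F : R) : darboux δ f (j + 1) F =
    δ (darboux δ f j F) - dlog δ (darboux δ f j (f (j + 1))) * darboux δ f j F := rfl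

/-- The transform is a monic differential operator of order $j$ whose coefficients do not depend on
$F$; this supplies the unitriangular matrix in Crum's formula. -/
theorem darboux_expansion (j : ℕ) : ∃ c : ℕ → R, c j = 1 ∧
    ∀ F, darboux δ f j F = ∑ i ∈ range (j + 1), c i * δ^[i] F := by
  induction j with
  | zero => exact ⟨fun _ => 1, rfl, fun F => by simp [darboux]⟩
  | succ j ih =>
    obtain ⟨c, hc, h⟩ := ih
    set e := dlog δ (darboux δ f j (f (j + 1))) with he
    refine ⟨fun i => (if i = 0 then 0 else c (i - 1)) +
      (if i < j + 1 then δ (c i) - e * c i else 0), by simp [hc], fun F => ?_⟩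
    rw [darboux_succ, ← he, h F, map_sum, mul_sum, ← sum_sub_distrib]
    simp only [add_mul]
    rw [sum_add_distrib, sum_range_succ' _ (j + 1), sum_range_succ _ (j + 1)]
    simp only [Nat.add_sub_cancel, Nat.succ_ne_zero, if_false, if_true, zero_mul, add_zero,
      lt_self_iff_false]
    rw [← sum_add_distrib]
    refine sum_congr rfl fun i hi => ?_
    rw [if_pos (mem_range.1 hi), Derivation.leibniz, ← Function.iterate_succ_apply' (f := δ)]
    simp only [smul_eq_mul]
    ring

variable {δ f}

theorem darboux_apply_of_lt {j i : ℕ} (hij : i < j)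
    (hu : ∀ m < j, IsUnit (darboux δ f m (f (m + 1)))) : darboux δ f j (f (i + 1)) = 0 := by
  induction j with
  | zero => omega
  | succ j ih =>
    rcases Nat.lt_succ_iff_lt_or_eq.1 hij with h | rfl
    · rw [darboux_succ, ih h fun m hm => hu m (by omega)]
      simp
    · rw [darboux_succ, dlog_mul_self δ (hu i (by omega)), sub_self]

/-- Crum's formula. -/
theorem wrSnoc_eq_prod_mul_darboux {j : ℕ}
    (hu : ∀ m < j, IsUnit (darboux δ f m (f (m + 1)))) (F : R) :
    wrSnoc δ f j F = (∏ i ∈ range j, darboux δ f i (f (i + 1))) * darboux δ f j F := by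
  choose c hc hexp using darboux_expansion δ f
  let g : Fin (j + 1) → R := Fin.snoc (α := fun _ => R) (fun β : Fin j => f (β + 1)) F
  let U : Matrix (Fin (j + 1)) (Fin (j + 1)) R :=
    Matrix.of fun α γ => if (γ : ℕ) ≤ α then c α γ else 0
  let N : Matrix (Fin (j + 1)) (Fin (j + 1)) R := Matrix.of fun α β => darboux δ f α (g β)
  -- Row operations by the unitriangular `U` turn the Wronskian matrix into the matrix of Darboux
  -- transforms, which is upper triangular because the transforms annihilate the earlier $f_i$.
  have hN : N = U * Matrix.of fun α β : Fin (j + 1) => δ^[(α : ℕ)] (g β) := by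
    ext α β
    simp only [N, U, Matrix.mul_apply, Matrix.of_apply, ite_mul, zero_mul]
    rw [hexp, Fin.sum_univ_eq_sum_range
      (fun γ => if γ ≤ (α : ℕ) then c α γ * δ^[γ] (g β) else 0), ← sum_filter]
    refine sum_congr ?_ fun _ _ => rfl
    ext γ
    simp only [mem_filter, mem_range]
    omega
  have hU : U.det = 1 := by
    rw [Matrix.det_of_isLowerTriangular]
    · simp [U, hc]
    · intro α γ h
      have : (α : ℕ) < γ := by simpa using h
      simp only [U, Matrix.of_apply]
      rw [if_neg (by omega)]
  have hdet : N.det = wrSnoc δ f j F := by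
    rw [hN, Matrix.det_mul, hU, one_mul]
    rfl
  rw [← hdet, Matrix.det_of_isUpperTriangular, Fin.prod_univ_castSucc,
    ← Fin.prod_univ_eq_prod_range (fun i => darboux δ f i (f (i + 1)))]
  · simp [N, g]
  · intro α β h
    have hlt : (β : ℕ) < α := by simpa using h
    have hβ : (β : ℕ) < j := by omega
    obtain ⟨β, rfl⟩ : ∃ b : Fin j, β = b.castSucc := ⟨⟨β, hβ⟩, rfl⟩
    simp only [N, g, Matrix.of_apply, Fin.snoc_castSucc]
    exact darboux_apply_of_lt hlt fun m hm => hu m (by omega)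

theorem wr_succ (j : ℕ) : wr δ f (j + 1) = wrSnoc δ f j (f (j + 1)) := by
  unfold wr wrSnoc
  congr 1
  ext β
  refine Fin.lastCases ?_ (fun β => ?_) β <;> simp

theorem wr_zero : wr δ f 0 = 1 := by simp [wr, wronskian]

theorem isUnit_wr (h : ∀ k, 1 ≤ k → IsUnit (wr δ f k)) (k : ℕ) : IsUnit (wr δ f k) := by
  rcases Nat.eq_zero_or_pos k with rfl | hk
  · rw [wr_zero]; exact isUnit_one
  · exact h k hk

/-- The transform is a factor of the invertible Wronskian of order $j+1$, by Crum's formula for the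
earlier steps. -/
theorem isUnit_darboux (h : ∀ k, 1 ≤ k → IsUnit (wr δ f k)) (j : ℕ) :
    IsUnit (darboux δ f j (f (j + 1))) := by
  induction j using Nat.strong_induction_on with
  | _ j ih =>
    have := h (j + 1) (by omega)
    rw [wr_succ, wrSnoc_eq_prod_mul_darboux ih] at this
    exact isUnit_of_mul_isUnit_right this

theorem wr_eq_prod (h : ∀ k, 1 ≤ k → IsUnit (wr δ f k)) (j : ℕ) :
    wr δ f j = ∏ i ∈ range j, darboux δ f i (f (i + 1)) := by
  cases j with
  | zero => simp [wr_zero]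
  | succ j =>
    rw [wr_succ, wrSnoc_eq_prod_mul_darboux fun m _ => isUnit_darboux h m, prod_range_succ]

theorem wrSnoc_eq (h : ∀ k, 1 ≤ k → IsUnit (wr δ f k)) (j : ℕ) (F : R) :
    wrSnoc δ f j F = wr δ f j * darboux δ f j F := by
  rw [wrSnoc_eq_prod_mul_darboux (fun m _ => isUnit_darboux h m), wr_eq_prod h]

theorem wr_succ_mul_inverse (h : ∀ k, 1 ≤ k → IsUnit (wr δ f k)) (j : ℕ) :
    wr δ f (j + 1) * Ring.inverse (wr δ f j) = darboux δ f j (f (j + 1)) := by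
  have := Ring.mul_inverse_cancel _ (isUnit_wr h j)
  rw [wr_succ, wrSnoc_eq h]
  linear_combination darboux δ f j (f (j + 1)) * this

theorem wrSnoc_mul_inverse (h : ∀ k, 1 ≤ k → IsUnit (wr δ f k)) (j : ℕ) (F : R) :
    wrSnoc δ f j F * Ring.inverse (wr δ f (j + 1)) =
      darboux δ f j F * Ring.inverse (darboux δ f j (f (j + 1))) := by
  have h1 := Ring.mul_inverse_cancel _ (isUnit_wr h j)
  rw [wr_succ, wrSnoc_eq h, wrSnoc_eq h, Ring.mul_inverse_rev]
  linear_combination darboux δ f j F * Ring.inverse (darboux δ f j (f (j + 1))) * h1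

/-- Functions with invertible Wronskian are linearly independent over the constants. -/
theorem eq_zero_of_sum_mul_eq_zero {n : ℕ} (hu : IsUnit (wr δ f n)) {a : Fin n → R}
    (ha : ∀ i, δ (a i) = 0) (h : ∑ i : Fin n, f (i + 1) * a i = 0) (i : Fin n) : a i = 0 := by
  -- Differentiating the relation moves only the $f_i$, so the vector of constants lies in the
  -- kernel of the Wronskian matrix.
  have key : ∀ m : ℕ, ∑ i : Fin n, δ^[m] (f (i + 1)) * a i = 0 := fun m => by
    induction m with
    | zero => exact h
    | succ m ih =>
      have := congrArg δ ih
      rw [map_sum, map_zero] at this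
      rw [← this]
      refine sum_congr rfl fun i _ => ?_
      rw [Derivation.leibniz, ha, smul_zero, zero_add, smul_eq_mul, Function.iterate_succ_apply',
        mul_comm]
  have hinj := Matrix.mulVec_injective_of_isUnit ((Matrix.isUnit_iff_isUnit_det _).2 hu)
  have : a = 0 := hinj (by
    ext α
    simpa [Matrix.mulVec, dotProduct] using key α)
  rw [this, Pi.zero_apply]

end GhostKP

namespace GhostKP

open PDO Finset

variable {R : Type*} [CommRing R] [Algebra ℚ R]

theorem sum_Icc_one {M : Type*} [AddCommMonoid M] (g : ℕ → M) (s : ℕ) :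
    ∑ j ∈ Icc 1 s, g j = ∑ j ∈ range s, g (j + 1) := by
  rw [range_eq_Ico, sum_Ico_add' g 0 s 1]
  rfl

variable {t tb : ℕ → Derivation ℚ R R} {L : PDO (t 1)} {Φ Ψ : ℕ → R} {S : ℕ → ℕ → R}

theorem wr_one (δ : Derivation ℚ R R) (f : ℕ → R) : wr δ f 1 = f 1 := by
  simp [wr, wronskian]

/-! ### The ghost flows of the potentials -/

/-- The difference between `∂S_{kj}/∂t̄_s` and the expression whose `x`-derivative is
`∂(Φ_k Ψ_j)/∂t̄_s`. -/
noncomputable def potentialDefect (tb : ℕ → Derivation ℚ R R) (S : ℕ → ℕ → R) (s k j : ℕ) : R :=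
  tb s (S k j) - (∑ i ∈ Icc 1 s, S (s - i + 1) j * S k i - S (k + s) j + S k (j + s))

namespace IsSystem

variable (h : IsSystem t tb L Φ Ψ S)
include h

theorem isUnit_Φ : IsUnit (Φ 1) := by
  simpa [wr_one] using h.isUnit_wr_Φ 1 le_rfl

theorem t_potentialDefect {s k j : ℕ} (hs : 1 ≤ s) (hk : 1 ≤ k) (hj : 1 ≤ j) :
    t 1 (potentialDefect tb S s k j) = 0 := by
  have h1 : t 1 (tb s (S k j)) = tb s (Φ k * Ψ j) := by
    rw [h.comm_t_tb 1 s _ le_rfl hs, h.potential k j hk hj]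
  have h2 : ∀ i ∈ Icc 1 s, t 1 (S (s - i + 1) j * S k i) =
      Φ (s - i + 1) * S k i * Ψ j + Φ k * (Ψ i * S (s - i + 1) j) := fun i hi => by
    rw [Derivation.leibniz, h.potential _ _ (by omega) hj,
      h.potential _ _ hk (mem_Icc.1 hi).1, smul_eq_mul, smul_eq_mul]
    ring
  rw [potentialDefect, map_sub, map_add, map_sub, map_sum, h1, sum_congr rfl h2, sum_add_distrib,
    ← sum_mul, ← mul_sum, h.potential _ _ (by omega) hj, h.potential _ _ hk (by omega),
    Derivation.leibniz, h.ghost_Φ s k hs hk, h.ghost_Ψ s j hs hj, smul_eq_mul, smul_eq_mul]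
  ring

/-- This is what remains of $[\partial_{\bar t_1},\partial_{\bar t_s}]\Phi_k=0$ after all terms free
of defects cancel. -/
theorem sum_mul_potentialDefect {s k : ℕ} (hs : 1 ≤ s) (hk : 1 ≤ k) :
    ∑ j ∈ range s, Φ (s - j) * potentialDefect tb S 1 k (j + 1)
      = Φ 1 * potentialDefect tb S s k 1 := by
  have hΦ : ∀ k, 1 ≤ k → tb 1 (Φ k) = Φ 1 * S k 1 - Φ (k + 1) := fun k hk => by
    simpa using h.ghost_Φ 1 k le_rfl hk
  have hS : ∀ j, tb 1 (S k (j + 1)) = potentialDefect tb S 1 k (j + 1) +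
      (S 1 (j + 1) * S k 1 - S (k + 1) (j + 1) + S k (j + 2)) := fun j => by
    simp [potentialDefect]
  have hSs : tb s (S k 1) = potentialDefect tb S s k 1 +
      (∑ j ∈ range s, S (s - j) 1 * S k (j + 1) - S (k + s) 1 + S k (1 + s)) := by
    rw [potentialDefect, sum_Icc_one]
    rw [sum_congr rfl fun j hj => by
      rw [show s - (j + 1) + 1 = s - j by have := mem_range.1 hj; omega]]
    ring
  have hΦs : ∀ k, 1 ≤ k →
      tb s (Φ k) = ∑ j ∈ range s, Φ (s - j) * S k (j + 1) - Φ (k + s) := fun k hk => by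
    rw [h.ghost_Φ s k hs hk, sum_Icc_one]
    rw [sum_congr rfl fun j hj => by
      rw [show s - (j + 1) + 1 = s - j by have := mem_range.1 hj; omega]]
  have hcomm := h.comm_tb 1 s (Φ k) le_rfl hs
  rw [hΦs k hk, hΦ k hk, map_sub, map_sub, map_sum, hΦ _ (by omega), Derivation.leibniz,
    hΦs _ (by omega : 1 ≤ k + 1), hΦs 1 le_rfl, hSs] at hcomm
  simp only [smul_eq_mul] at hcomm
  -- The last bracket is arranged to telescope over `j`.
  have hterm : ∀ j ∈ range s, tb 1 (Φ (s - j) * S k (j + 1)) =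
      Φ (s - j) * potentialDefect tb S 1 k (j + 1) + S k 1 * (Φ (s - j) * S 1 (j + 1))
      + Φ 1 * (S (s - j) 1 * S k (j + 1)) - Φ (s - j) * S (k + 1) (j + 1)
      + (Φ (s + 1 - (j + 1)) * S k (j + 1 + 1) - Φ (s + 1 - j) * S k (j + 1)) := fun j hj => by
    have hj := mem_range.1 hj
    rw [Derivation.leibniz, hS, hΦ _ (by omega), show s - j + 1 = s + 1 - j by omega,
      show s + 1 - (j + 1) = s - j by omega]
    simp only [smul_eq_mul]
    ring
  rw [sum_congr rfl hterm, sum_add_distrib, sum_sub_distrib, sum_add_distrib, sum_add_distrib,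
    ← mul_sum, ← mul_sum, sum_range_sub (fun j => Φ (s + 1 - j) * S k (j + 1))] at hcomm
  simp only [Nat.add_sub_cancel_left, Nat.sub_zero, zero_add] at hcomm
  rw [show k + s + 1 = k + 1 + s by ring, add_comm 1 s] at hcomm
  linear_combination hcomm

/-- Since the whole sequence of flows commutes and the `Φ_k` are independent over the constants,
the potentials have no free integration constants along `t̄_1`. -/
theorem potentialDefect_one {k j : ℕ} (hk : 1 ≤ k) (hj : 1 ≤ j) :
    potentialDefect tb S 1 k j = 0 := by
  -- The choice $s=j+1$ makes the wanted defect the coefficient of $\Phi_2$; the unknown defect of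
  -- the $s$-th flow affects only the coefficient of $\Phi_1$.
  have h1 := h.sum_mul_potentialDefect (s := j + 1) (by omega) hk
  let a : Fin (j + 1) → R := fun m => potentialDefect tb S 1 k (j + 1 - m) -
    if (m : ℕ) = 0 then potentialDefect tb S (j + 1) k 1 else 0
  have ha : ∀ m, t 1 (a m) = 0 := fun m => by
    simp only [a, map_sub]
    rw [h.t_potentialDefect le_rfl hk (by omega)]
    split_ifs
    · rw [h.t_potentialDefect (by omega) hk le_rfl, sub_zero]
    · simp
  have hsum : ∑ m : Fin (j + 1), Φ (m + 1) * a m = 0 := by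
    simp only [a, mul_sub, sum_sub_distrib]
    rw [Fin.sum_univ_eq_sum_range
        (fun m => Φ (m + 1) * potentialDefect tb S 1 k (j + 1 - m)) (j + 1),
      Fin.sum_univ_eq_sum_range
        (fun m => Φ (m + 1) * if m = 0 then potentialDefect tb S (j + 1) k 1 else 0) (j + 1),
      ← sum_range_reflect, sub_eq_zero]
    simp only [mul_ite, mul_zero, sum_ite_eq', mem_range, Nat.succ_pos, if_true, zero_add]
    rw [← h1]
    refine sum_congr rfl fun m hm => ?_
    have := mem_range.1 hm
    rw [show j + 1 - 1 - m + 1 = j + 1 - m by omega,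
      show j + 1 - (j + 1 - 1 - m) = m + 1 by omega]
  have := eq_zero_of_sum_mul_eq_zero (h.isUnit_wr_Φ (j + 1) (by omega)) ha hsum ⟨1, by omega⟩
  simpa [a] using this

theorem tb_one_potential {k j : ℕ} (hk : 1 ≤ k) (hj : 1 ≤ j) :
    tb 1 (S k j) = S 1 j * S k 1 - S (k + 1) j + S k (j + 1) := by
  have := h.potentialDefect_one hk hj
  rw [potentialDefect, sub_eq_zero] at this
  simpa using this

end IsSystem

/-! ### The operators generated by the potentials -/

/-- The operator `Y_j = D̄ ^ j + ∑_{k ≥ 1} S_{kj} D̄ ^ (1-k)`. -/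
noncomputable def potentialOp (tb : ℕ → Derivation ℚ R R) (S : ℕ → ℕ → R) (j : ℕ) : PDO (tb 1) :=
  ⟨fun n => if n ≤ 0 then S (1 - n).toNat j else if n = j then 1 else 0, j, fun n hn => by
    rw [if_neg (by omega), if_neg (by omega)]⟩

theorem coeff_potentialOp (j : ℕ) (n : ℤ) : (potentialOp tb S j).coeff n =
    if n ≤ 0 then S (1 - n).toNat j else if n = j then 1 else 0 := rfl

theorem coeff_Wbar (hΦ : IsUnit (Φ 1)) (n : ℤ) : (Wbar tb Φ).coeff n =
    if n ≤ 0 then Φ ((-n).toNat + 1) * Ring.inverse (Φ 1) else 0 := by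
  rw [Wbar, coeff_add, coeff_one, coeff_lowerSeries]
  rcases lt_trichotomy n 0 with hn | rfl | hn
  · rw [if_neg (by omega), if_pos hn, if_pos (by omega), zero_add]
  · simp [Ring.mul_inverse_cancel _ hΦ]
  · rw [if_neg (by omega), if_neg (by omega), if_neg (by omega), zero_add]

theorem isMonic_Wbar : IsMonic (Wbar tb Φ) 0 :=
  ⟨ordLE_one.add ((ordLE_lowerSeries _).mono (by omega)), by
    simp [Wbar, coeff_one, coeff_lowerSeries]⟩

theorem ordLE_mapCoeff_Wbar (d : Derivation ℚ R R) :
    OrdLE (mapCoeff d (Wbar tb Φ)) (-1) := fun n hn => by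
  rw [coeff_mapCoeff, Wbar, coeff_add, coeff_lowerSeries, if_neg (by omega), coeff_one]
  split_ifs <;> simp

namespace IsSystem

variable (h : IsSystem t tb L Φ Ψ S)
include h

/-- In nonpositive degrees this is the $\bar t_1$-flow of the potentials; in degree 1 the shifted
$S_{1j}$ is matched by the leading term of $Y_1$. -/
theorem D_mul_potentialOp {j : ℕ} (hj : 1 ≤ j) : D (tb 1) 1 * potentialOp tb S j =
    potentialOp tb S (j + 1) + C (tb 1) (S 1 j) * potentialOp tb S 1 := by
  ext n
  rw [coeff_D_one_mul, coeff_add, coeff_C_mul]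
  simp only [coeff_potentialOp]
  rcases lt_trichotomy n 1 with hn | rfl | hn
  · rw [if_pos (by omega), if_pos (by omega), if_pos (by omega), if_pos (by omega),
      h.tb_one_potential (by omega) hj,
      show (1 - (n - 1)).toNat = (1 - n).toNat + 1 by omega]
    ring
  · simp only [sub_self, le_refl, if_true, Int.reduceLE, if_false, Nat.cast_one, mul_one]
    rw [if_neg (by omega : ¬ (1 : ℤ) = ((j + 1 : ℕ) : ℤ))]
    split_ifs <;> simp
  · have h1 : ¬ n ≤ 0 := by omega
    have h2 : ¬ n - 1 ≤ 0 := by omega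
    have h3 : n ≠ ((1 : ℕ) : ℤ) := by omega
    have h4 : n - 1 = j ↔ n = (j + 1 : ℕ) := by push_cast; omega
    simp only [h1, h2, h3, h4, if_false]
    split_ifs <;> simp

/-- The factor is $\Phi_1^{-1}\bar D\Phi_1$ and $\Phi_1\bar W=\sum_{k\ge0}\Phi_{k+1}\bar D^{-k}$, so
the claim is $\bar\partial\Phi_k+\Phi_{k+1}=\Phi_1S_{k1}$. -/
theorem factors_zero_mul_Wbar : factors t tb Φ Ψ 0 * Wbar tb Φ = potentialOp tb S 1 := by
  have hu := h.isUnit_Φ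
  have h1 := Ring.mul_inverse_cancel _ hu
  rw [factors, dlog_inverse _ hu, C_neg, sub_neg_eq_add, add_mul]
  ext n
  rw [coeff_add, coeff_D_one_mul, coeff_C_mul, coeff_potentialOp]
  simp only [coeff_Wbar hu]
  rcases lt_trichotomy n 1 with hn | rfl | hn
  · rw [if_pos (by omega), if_pos (by omega), if_pos (by omega), Derivation.leibniz,
      derivation_inverse _ hu, h.ghost_Φ 1 ((-n).toNat + 1) le_rfl (by omega),
      show (1 - n).toNat = (-n).toNat + 1 by omega,
      show (-(n - 1)).toNat + 1 = (-n).toNat + 1 + 1 by omega, dlog]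
    simp only [smul_eq_mul, Icc_self, sum_singleton, Nat.sub_self, zero_add]
    linear_combination S ((-n).toNat + 1) 1 * h1
  · simp [h1]
  · rw [if_neg (by omega), if_neg (by omega), if_neg (by omega), if_neg (by omega)]
    simp

theorem mapCoeff_Wbar_add {s : ℕ} (hs : 1 ≤ s) :
    mapCoeff (tb s) (Wbar tb Φ) + Wbar tb Φ * D (tb 1) s =
      ∑ j ∈ Icc 1 s, C (tb 1) (Φ (s - j + 1) * Ring.inverse (Φ 1)) * potentialOp tb S j
        - C (tb 1) (dlog (tb s) (Φ 1)) * Wbar tb Φ := by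
  have hu := h.isUnit_Φ
  ext n
  rw [coeff_add, coeff_sub, coeff_sum, coeff_mapCoeff, coeff_mul_D, coeff_C_mul]
  simp only [coeff_C_mul, coeff_potentialOp, coeff_Wbar hu]
  by_cases hn : n ≤ 0
  · simp only [if_pos hn]
    rw [if_pos (by omega), Derivation.leibniz, derivation_inverse _ hu,
      h.ghost_Φ s ((-n).toNat + 1) hs (by omega), show (1 - n).toNat = (-n).toNat + 1 by omega,
      show (-(n - s)).toNat + 1 = (-n).toNat + 1 + s by omega, dlog]
    have : ∑ j ∈ Icc 1 s, Φ (s - j + 1) * Ring.inverse (Φ 1) * S ((-n).toNat + 1) j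
        = Ring.inverse (Φ 1) * ∑ j ∈ Icc 1 s, Φ (s - j + 1) * S ((-n).toNat + 1) j := by
      rw [mul_sum]
      exact sum_congr rfl fun _ _ => by ring
    rw [this]
    simp only [smul_eq_mul]
    ring
  -- In positive degrees only the leading terms $\bar D^j$ of the $Y_j$ survive; they match the top
  -- coefficients of $\bar W\bar D^s$.
  · simp only [if_neg hn, map_zero, zero_add, mul_zero, sub_zero, mul_ite, mul_one]
    obtain ⟨m, rfl⟩ : ∃ m : ℕ, n = m := ⟨n.toNat, by omega⟩
    simp only [Nat.cast_inj, sum_ite_eq, mem_Icc]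
    split_ifs <;> first | omega | rfl | skip
    congr 2
    omega

end IsSystem

/-! ### Gaussian elimination along the Darboux transformations -/

/-- The ratio of Darboux transforms `𝒲_j(Ψ_k) / 𝒲_{j+1}`. -/
noncomputable def darbouxRatio (δ : Derivation ℚ R R) (Ψ : ℕ → R) (j k : ℕ) : R :=
  darboux δ Ψ j (Ψ k) * Ring.inverse (darboux δ Ψ j (Ψ (j + 1)))

/-- The operators obtained from the `Y_k` by eliminating the first `j` of them. -/
noncomputable def reducedOp (t tb : ℕ → Derivation ℚ R R) (Ψ : ℕ → R) (S : ℕ → ℕ → R) :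
    ℕ → ℕ → PDO (tb 1)
  | 0, k => potentialOp tb S k
  | j + 1, k => reducedOp t tb Ψ S j k -
      C (tb 1) (darbouxRatio (t 1) Ψ j k) * reducedOp t tb Ψ S j (j + 1)

/-- The coefficients of the `∂̄`-evolution after `j` steps of elimination. -/
noncomputable def evolutionCoeff (δ : Derivation ℚ R R) (Ψ : ℕ → R) (S : ℕ → ℕ → R) : ℕ → ℕ → R
  | 0, k => S 1 k
  | j + 1, k => -darbouxRatio δ Ψ j k

theorem darboux_succ_eq (δ : Derivation ℚ R R) (f : ℕ → R) {j : ℕ}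
    (hu : IsUnit (darboux δ f j (f (j + 1)))) (k : ℕ) :
    darboux δ f (j + 1) (f k) = darboux δ f j (f (j + 1)) * δ (darbouxRatio δ f j k) := by
  have h1 := Ring.mul_inverse_cancel _ hu
  rw [darboux_succ, darbouxRatio, Derivation.leibniz, derivation_inverse δ hu, dlog]
  simp only [smul_eq_mul]
  linear_combination (δ (darboux δ f j (f (j + 1))) * Ring.inverse (darboux δ f j (f (j + 1))) *
    darboux δ f j (f k) - δ (darboux δ f j (f k))) * h1

namespace IsSystem

variable (h : IsSystem t tb L Φ Ψ S)
include h

/-- Operators and functions obey one recursion, so one multiplier eliminates in both. The third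
clause carries the induction: it makes the `evolutionCoeff` terms drop out of the $x$-derivative of
the evolution of the ratios. -/
theorem evolution (j : ℕ) : ∃ ρ : R, ∀ k, 1 ≤ k →
    D (tb 1) 1 * reducedOp t tb Ψ S j k = reducedOp t tb Ψ S j (k + 1) +
      C (tb 1) (evolutionCoeff (t 1) Ψ S j k) * reducedOp t tb Ψ S j (j + 1) ∧
    tb 1 (darboux (t 1) Ψ j (Ψ k)) = darboux (t 1) Ψ j (Ψ (k + 1)) +
      evolutionCoeff (t 1) Ψ S j k * darboux (t 1) Ψ j (Ψ (j + 1)) ∧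
    t 1 (evolutionCoeff (t 1) Ψ S j k) = ρ * darboux (t 1) Ψ j (Ψ k) := by
  induction j with
  | zero =>
    refine ⟨Φ 1, fun k hk => ⟨h.D_mul_potentialOp hk, ?_, h.potential 1 k le_rfl hk⟩⟩
    simp only [darboux, evolutionCoeff]
    rw [h.ghost_Ψ 1 k le_rfl hk]
    simp only [Icc_self, sum_singleton, Nat.sub_self, zero_add]
    ring
  | succ j ih =>
    obtain ⟨ρ, ih⟩ := ih
    have hu := isUnit_darboux h.isUnit_wr_Ψ j
    have h1 := Ring.mul_inverse_cancel _ hu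
    have hratio : ∀ k, 1 ≤ k → tb 1 (darbouxRatio (t 1) Ψ j k) =
        darbouxRatio (t 1) Ψ j (k + 1) + evolutionCoeff (t 1) Ψ S j k -
        darbouxRatio (t 1) Ψ j k * (darbouxRatio (t 1) Ψ j (j + 1 + 1) +
          evolutionCoeff (t 1) Ψ S j (j + 1)) := fun k hk => by
      simp only [darbouxRatio]
      rw [Derivation.leibniz, derivation_inverse _ hu, (ih k hk).2.1, (ih (j + 1) (by omega)).2.1]
      simp only [smul_eq_mul]
      linear_combination (evolutionCoeff (t 1) Ψ S j k - darboux (t 1) Ψ j (Ψ k) *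
        Ring.inverse (darboux (t 1) Ψ j (Ψ (j + 1))) * evolutionCoeff (t 1) Ψ S j (j + 1)) * h1
    refine ⟨-Ring.inverse (darboux (t 1) Ψ j (Ψ (j + 1))), fun k hk => ⟨?_, ?_, ?_⟩⟩
    · simp only [reducedOp, evolutionCoeff]
      rw [mul_sub, D_one_mul_C_mul, (ih k hk).1, (ih (j + 1) (by omega)).1, hratio k hk]
      ext n
      simp only [coeff_sub, coeff_add, coeff_C_mul]
      ring
    · have hk' := hratio k hk
      -- The next transform is the pivot times the $x$-derivative of the ratio. In this derivative
      -- the $\rho$-terms cancel, since ratio times pivot is the transform of $\Psi_k$.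
      have e := congrArg (t 1) hk'
      simp only [map_add, map_sub, Derivation.leibniz, smul_eq_mul, (ih k hk).2.2,
        (ih (j + 1) (by omega)).2.2] at e
      rw [← h.comm_t_tb 1 1 _ le_rfl le_rfl |>.symm] at e
      have hl : darbouxRatio (t 1) Ψ j k * darboux (t 1) Ψ j (Ψ (j + 1)) =
          darboux (t 1) Ψ j (Ψ k) := by
        rw [darbouxRatio, mul_assoc, Ring.inverse_mul_cancel _ hu, mul_one]
      have hl' : darbouxRatio (t 1) Ψ j (j + 1 + 1) * darboux (t 1) Ψ j (Ψ (j + 1)) =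
          darboux (t 1) Ψ j (Ψ (j + 1 + 1)) := by
        rw [darbouxRatio, mul_assoc, Ring.inverse_mul_cancel _ hu, mul_one]
      simp only [evolutionCoeff]
      rw [darboux_succ_eq _ _ hu, darboux_succ_eq _ _ hu, darboux_succ_eq _ _ hu,
        Derivation.leibniz, (ih (j + 1) (by omega)).2.1, ← hl']
      simp only [smul_eq_mul]
      linear_combination darboux (t 1) Ψ j (Ψ (j + 1)) * e -
        darboux (t 1) Ψ j (Ψ (j + 1)) * ρ * hl
    · simp only [evolutionCoeff, map_neg]
      rw [darboux_succ_eq _ _ hu]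
      linear_combination t 1 (darbouxRatio (t 1) Ψ j k) * h1

theorem reducedOp_diag (j : ℕ) :
    reducedOp t tb Ψ S j (j + 1) = factors t tb Φ Ψ j * Wbar tb Φ := by
  induction j with
  | zero => exact h.factors_zero_mul_Wbar.symm
  | succ j ih =>
    obtain ⟨ρ, hρ⟩ := h.evolution j
    have hu := isUnit_darboux h.isUnit_wr_Ψ j
    have h1 := Ring.mul_inverse_cancel _ hu
    obtain ⟨e1, e2, -⟩ := hρ (j + 1) (by omega)
    -- The logarithmic derivative of the pivot combines the evolution coefficient with the next
    -- multiplier, so the first-order factor performs exactly one elimination step.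
    have hd : dlog (tb 1) (darboux (t 1) Ψ j (Ψ (j + 1))) =
        darbouxRatio (t 1) Ψ j (j + 1 + 1) + evolutionCoeff (t 1) Ψ S j (j + 1) := by
      rw [dlog, e2, darbouxRatio]
      linear_combination evolutionCoeff (t 1) Ψ S j (j + 1) * h1
    rw [factors, wr_succ_mul_inverse h.isUnit_wr_Ψ, mul_assoc, ← ih, sub_mul, e1, hd, C_add,
      reducedOp]
    noncomm_ring

/-- The elimination steps telescope, and after $k+1$ of them $Y_{k+1}$ has been reduced to zero. -/
theorem potentialOp_eq_sum (k : ℕ) : potentialOp tb S (k + 1) = ∑ j ∈ range (k + 1),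
    C (tb 1) (darbouxRatio (t 1) Ψ j (k + 1)) * (factors t tb Φ Ψ j * Wbar tb Φ) := by
  have htel : ∀ m, reducedOp t tb Ψ S m (k + 1) = potentialOp tb S (k + 1) - ∑ j ∈ range m,
      C (tb 1) (darbouxRatio (t 1) Ψ j (k + 1)) * (factors t tb Φ Ψ j * Wbar tb Φ) := fun m => by
    induction m with
    | zero => simp [reducedOp]
    | succ m ih => rw [reducedOp, ih, sum_range_succ, h.reducedOp_diag, sub_sub]
  have hz : reducedOp t tb Ψ S (k + 1) (k + 1) = 0 := by
    rw [reducedOp, darbouxRatio, Ring.mul_inverse_cancel _ (isUnit_darboux h.isUnit_wr_Ψ k),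
      C_one, one_mul, sub_self]
  have := htel (k + 1)
  rw [hz] at this
  exact (sub_eq_zero.1 this.symm)

theorem Mbar_mul_Wbar {s : ℕ} (hs : 1 ≤ s) : Mbar t tb Φ Ψ s * Wbar tb Φ =
    mapCoeff (tb s) (Wbar tb Φ) + Wbar tb Φ * D (tb 1) s := by
  rw [h.mapCoeff_Wbar_add hs, Mbar, sub_mul, sum_mul]
  congr 1
  ext n
  simp only [coeff_sum, mul_assoc, coeff_C_mul, sum_mul]
  -- Interchanging the sums over $j\le k\le s$ makes the inner sum over `j` the expansion of $Y_k$.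
  rw [sum_comm' (t' := Icc 1 s) (s' := fun k => Icc 1 k)
    (by intro j k; simp only [mem_Icc]; omega)]
  refine sum_congr rfl fun k hk => ?_
  obtain ⟨k, rfl⟩ : ∃ m, k = m + 1 := ⟨k - 1, by have := (mem_Icc.1 hk).1; omega⟩
  rw [h.potentialOp_eq_sum k, coeff_sum, sum_Icc_one, mul_sum, mul_sum]
  refine sum_congr rfl fun j _ => ?_
  rw [coeff_C_mul, Nat.add_sub_cancel, ← mul_assoc (wrSnoc _ _ _ _), wrSnoc_mul_inverse h.isUnit_wr_Ψ, darbouxRatio]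

end IsSystem

theorem coeff_factors_of_neg (i : ℕ) : ∀ n < 0, (factors t tb Φ Ψ i).coeff n = 0 := by
  induction i with
  | zero =>
    intro n hn
    rw [factors, coeff_sub, coeff_D, if_neg (by omega), C, coeff_monomial, if_neg (by omega),
      sub_zero]
  | succ i ih =>
    intro n hn
    rw [factors, sub_mul, coeff_sub, coeff_D_one_mul, coeff_C_mul, ih n hn, ih _ (by omega)]
    simp

theorem coeff_Mbar_of_neg (s : ℕ) : ∀ n < 0, (Mbar t tb Φ Ψ s).coeff n = 0 := by
  intro n hn
  rw [Mbar, coeff_sub, coeff_sum, C, coeff_monomial, if_neg (by omega), sub_zero]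
  refine sum_eq_zero fun j _ => ?_
  rw [coeff_C_mul, coeff_factors_of_neg _ n hn, mul_zero]

/-! ### The Lax operator of the ghost flows -/

/-- The operator `W̄ D̄ W̄⁻¹`. -/
noncomputable def dressedLax (tb : ℕ → Derivation ℚ R R) (Φ : ℕ → R) : PDO (tb 1) :=
  Wbar tb Φ * D (tb 1) 1 * Ring.inverse (Wbar tb Φ)

theorem dressedLax_pow_mul_Wbar (s : ℕ) :
    dressedLax tb Φ ^ s * Wbar tb Φ = Wbar tb Φ * D (tb 1) s := by
  have hW := (isMonic_Wbar (tb := tb) (Φ := Φ)).isUnit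
  induction s with
  | zero => rw [pow_zero, Nat.cast_zero, D_zero, one_mul, mul_one]
  | succ s ih =>
    rw [pow_succ', mul_assoc, ih, dressedLax, mul_assoc, ← mul_assoc (Ring.inverse _),
      Ring.inverse_mul_cancel _ hW, one_mul, mul_assoc, D_mul_D]
    push_cast
    rw [add_comm]

/-- From $\bar W\bar D=\bar D\bar W-\bar\partial\bar W$; it yields both the KP form and the value of
$b_1$. -/
theorem dressedLax_sub_D : dressedLax tb Φ - D (tb 1) 1 =
    -(mapCoeff (tb 1) (Wbar tb Φ) * Ring.inverse (Wbar tb Φ)) := by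
  have hW := (isMonic_Wbar (tb := tb) (Φ := Φ)).isUnit
  have h1 : Wbar tb Φ * D (tb 1) 1 = D (tb 1) 1 * Wbar tb Φ - mapCoeff (tb 1) (Wbar tb Φ) := by
    rw [D_one_mul, add_sub_cancel_right]
  rw [dressedLax, h1, sub_mul, mul_assoc, Ring.mul_inverse_cancel _ hW, mul_one]
  abel

theorem isKPForm_dressedLax : IsKPForm (dressedLax tb Φ) := by
  rw [isKPForm_iff, dressedLax_sub_D]
  exact ((ordLE_mapCoeff_Wbar _).mul isMonic_Wbar.inverse.ordLE).neg.mono (by omega)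

theorem coeff_dressedLax_sub_D : (dressedLax tb Φ - D (tb 1) 1).coeff (-1) =
    -tb 1 (Φ 2 * Ring.inverse (Φ 1)) := by
  have := (ordLE_mapCoeff_Wbar (Φ := Φ) (tb 1)).coeff_mul
    (isMonic_Wbar (tb := tb) (Φ := Φ)).inverse.ordLE
  rw [isMonic_Wbar.inverse.coeff_eq_one] at this
  rw [dressedLax_sub_D, coeff_neg]
  simp only [neg_zero, add_zero] at this
  rw [this]
  simp [coeff_mapCoeff, Wbar, coeff_one, coeff_lowerSeries]

theorem IsSystem.Mbar_sub_dressedLax_pow (h : IsSystem t tb L Φ Ψ S) {s : ℕ} (hs : 1 ≤ s) :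
    Mbar t tb Φ Ψ s - dressedLax tb Φ ^ s =
      mapCoeff (tb s) (Wbar tb Φ) * Ring.inverse (Wbar tb Φ) := by
  have hW := (isMonic_Wbar (tb := tb) (Φ := Φ)).isUnit
  have h1 : (Mbar t tb Φ Ψ s - dressedLax tb Φ ^ s) * Wbar tb Φ =
      mapCoeff (tb s) (Wbar tb Φ) := by
    rw [sub_mul, h.Mbar_mul_Wbar hs, dressedLax_pow_mul_Wbar, add_sub_cancel_right]
  rw [← h1, mul_assoc, Ring.mul_inverse_cancel _ hW, mul_one]

theorem IsSystem.Mbar_eq_posPart (h : IsSystem t tb L Φ Ψ S) {s : ℕ} (hs : 1 ≤ s) :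
    Mbar t tb Φ Ψ s = posPart (dressedLax tb Φ ^ s) := by
  rw [← posPart_eq_self_of_coeff_neg (coeff_Mbar_of_neg (t := t) (tb := tb) (Φ := Φ) (Ψ := Ψ) s)]
  refine posPart_eq_of_sub_ordLE ?_
  rw [h.Mbar_sub_dressedLax_pow hs]
  exact ((ordLE_mapCoeff_Wbar _).mul isMonic_Wbar.inverse.ordLE).mono (by omega)

theorem IsSystem.isGhostLax_dressedLax (h : IsSystem t tb L Φ Ψ S) :
    IsGhostLax t tb Φ Ψ (dressedLax tb Φ) :=
  ⟨isKPForm_dressedLax, fun _ hs => h.Mbar_eq_posPart hs⟩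

theorem IsSystem.mapCoeff_Wbar (h : IsSystem t tb L Φ Ψ S) {s : ℕ} (hs : 1 ≤ s) :
    mapCoeff (tb s) (Wbar tb Φ) = -negPart (dressedLax tb Φ ^ s) * Wbar tb Φ := by
  have h1 := posPart_add_negPart (dressedLax tb Φ ^ s)
  rw [← h.Mbar_eq_posPart hs] at h1
  rw [← eq_sub_iff_add_eq'] at h1
  rw [h1, neg_sub, sub_mul, h.Mbar_mul_Wbar hs, dressedLax_pow_mul_Wbar, add_sub_cancel_right]

/-! ### Expansion in inverse first-order factors -/

theorem isMonic_invFactors (k : ℕ) : IsMonic (invFactors t tb Φ k) (-k) := by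
  induction k with
  | zero => exact isMonic_one
  | succ k ih =>
    have := (isMonic_D_one_add_C (δ := tb 1) (dlog (tb 1)
      (wr (t 1) Φ (k + 2) * Ring.inverse (wr (t 1) Φ (k + 1))))).inverse.mul ih
    rw [invFactors]
    convert this using 1
    push_cast
    ring

theorem hasExpansion_dressedLax : HasExpansion t tb Φ (dressedLax tb Φ) := by
  obtain ⟨b, hb, hsum⟩ := exists_expansion
    (isKPForm_iff.1 (isKPForm_dressedLax (tb := tb) (Φ := Φ)))
    (isMonic_invFactors (t := t) (tb := tb) (Φ := Φ))
  refine ⟨b, hb.trans coeff_dressedLax_sub_D, fun n => ?_⟩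
  rw [← hsum n, coeff_sub, add_sub_cancel]

end GhostKP

/-! ### The main theorem -/

theorem mainTheorem6 {R : Type*} [CommRing R] [Algebra ℚ R] (t tb : ℕ → Derivation ℚ R R)
    (L : PDO (t 1)) (Φ Ψ : ℕ → R) (S : ℕ → ℕ → R) (h : GhostKP.IsSystem t tb L Φ Ψ S) :
    IsUnit (GhostKP.Wbar tb Φ) ∧
    (∃! Lb : PDO (tb 1), GhostKP.IsGhostLax t tb Φ Ψ Lb) ∧
    ∀ Lb : PDO (tb 1), GhostKP.IsGhostLax t tb Φ Ψ Lb →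
      GhostKP.HasExpansion t tb Φ Lb ∧
      Lb = GhostKP.Wbar tb Φ * PDO.D (tb 1) 1 * Ring.inverse (GhostKP.Wbar tb Φ) ∧
      ∀ s, 1 ≤ s → PDO.mapCoeff (tb s) (GhostKP.Wbar tb Φ) =
        -PDO.negPart (Lb ^ s) * GhostKP.Wbar tb Φ := by
  have huniq : ∀ Lb, GhostKP.IsGhostLax t tb Φ Ψ Lb → Lb = GhostKP.dressedLax tb Φ :=
    fun Lb hLb => hLb.1.eq_of_posPart_pow GhostKP.isKPForm_dressedLax fun s hs => by
      rw [← hLb.2 s hs, h.Mbar_eq_posPart hs]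
  refine ⟨GhostKP.isMonic_Wbar.isUnit, ⟨_, h.isGhostLax_dressedLax, huniq⟩, fun Lb hLb => ?_⟩
  rw [huniq Lb hLb]
  exact ⟨GhostKP.hasExpansion_dressedLax, rfl, fun s hs => h.mapCoeff_Wbar hs⟩
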